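/- An operator algebra is a Banach algebra $A$ over $\mathbb C$ equipped with norms on all matrix spaces $M_n(A)$ (the norm on $M_1(A)$ being that of $A$), which has a two-sided contractive approximate identity and for which there is a homomorphism $A\to B(H)$, for some Hilbert space $H$, that is completely isometric, i.e. all of whose amplifications $M_n(A)\to M_n(B(H))=B(H^n)$ are isometric. For Hilbert spaces $H,K$, a $\sigma$-TRO is a norm closed linear subspace $M\subseteq B(H,K)$ with $MM^*M\subseteq M$ for which there are sequences $(m_i)_{i\in\mathbb N}$, $(n_i)_{i\in\mathbb N}$ in $M$ such that for all $m\in M$ $$\lim_l\sum_{i=1}^l m_im_i^*m=m=\lim_l\sum_{i=1}^l m\,n_i^*n_i \quad\text{(in norm)},\qquad \Big\|\sum_{i=1}^l m_im_i^*\Big\|\le 1,\quad \Big\|\sum_{i=1}^l n_i^*n_i\Big\|\le 1\quad\text{for all } l.$$ For operator algebras $\mathcal A\subseteq B(H)$ and $\mathcal B\subseteq B(K)$ write $\mathcal A\sim_{\sigma TRO}\mathcal B$ if there is a $\sigma$-TRO $M\subseteq B(H,K)$ such that $$\mathcal A=\overline{[M^*\mathcal BM]}^{\|\cdot\|},\qquad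 \mathcal B=\overline{[M\mathcal AM^*]}^{\|\cdot\|},$$ where $[S]$ denotes the linear span of $S$. For operator algebras $A,B$ write $A\sim_{\sigma\Delta}B$ if there are completely isometric homomorphisms $\alpha_0:A\to B(H_0)$ and $\beta_0:B\to B(K_0)$, on some Hilbert spaces $H_0,K_0$, with $\alpha_0(A)\sim_{\sigma TRO}\beta_0(B)$. **Theorem.** Let $A$ and $B$ be operator algebras with $A\sim_{\sigma\Delta}B$. Then for every Hilbert space $H$ and every completely isometric homomorphism $\alpha:A\to B(H)$ there are a Hilbert space $K$ and a completely isometric homomorphism $\beta:B\to B(K)$ such that $\alpha(A)\sim_{\sigma TRO}\beta(B)$. -/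

import Mathlib

universe u v w w₁ w₂

noncomputable section

open Filter Topology

namespace StableMaps

/-- The operator from `H^n` to `H^n` (Hilbert space direct sums) given by an `n × n` matrix of
bounded operators on `H`. -/
def opMatrix {H : Type w} [NormedAddCommGroup H] [InnerProductSpace ℂ H] {n : ℕ}
    (T : Matrix (Fin n) (Fin n) (H →L[ℂ] H)) :
    PiLp 2 (fun _ : Fin n => H) →L[ℂ] PiLp 2 (fun _ : Fin n => H) :=
  ((PiLp.continuousLinearEquiv 2 ℂ (fun _ : Fin n => H)).symm : _ →L[ℂ] _) ∘L
    ContinuousLinearMap.pi fun i => ∑ j, T i j ∘L PiLp.proj 2 (fun _ : Fin n => H) j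

theorem opMatrix_apply {H : Type w} [NormedAddCommGroup H] [InnerProductSpace ℂ H] {n : ℕ}
    (T : Matrix (Fin n) (Fin n) (H →L[ℂ] H)) (x : PiLp 2 (fun _ : Fin n => H)) (i : Fin n) :
    opMatrix T x i = ∑ j, T i j (x j) := by
  simp [opMatrix]

/-- A norm on each of the matrix spaces `M_n(A)`. The laws of these norms are
part of `OperatorAlgebra`. -/
class MatrixNormed (A : Type u) where
  matNorm : (n : ℕ) → Matrix (Fin n) (Fin n) A → ℝ

/-- A homomorphism `α : A → B(H)` is completely isometric if every amplification
`M_n(A) → M_n(B(H)) = B(H^n)` preserves the norm. -/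
def IsCompletelyIsometric {A : Type u} [NonUnitalNormedRing A] [NormedSpace ℂ A] [MatrixNormed A]
    {H : Type w} [NormedAddCommGroup H] [InnerProductSpace ℂ H]
    (α : A →ₙₐ[ℂ] (H →L[ℂ] H)) : Prop :=
  ∀ (n : ℕ) (x : Matrix (Fin n) (Fin n) A), ‖opMatrix (x.map α)‖ = MatrixNormed.matNorm n x

/-- A net (here: a filter) of elements of norm at most one which is a two-sided
approximate identity. -/
def HasContractiveApproximateIdentity (A : Type u) [NonUnitalNormedRing A] : Prop :=
  ∃ l : Filter A, l.IsApproximateUnit ∧ ∀ᶠ e in l, ‖e‖ ≤ 1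

/-- A (possibly non-self-adjoint, possibly non-unital) operator algebra: a Banach algebra with
matrix norms, having a contractive approximate identity, for which there is a completely isometric
homomorphism into some `B(H)`. The last condition makes `A` an operator space (it implies Ruan's
axioms for the matrix norms). By a cardinality argument the universe of `H` is no restriction. -/
class OperatorAlgebra (A : Type u) [NonUnitalNormedRing A] [NormedSpace ℂ A]
    [MatrixNormed A] : Prop where
  smul_mul_assoc' : ∀ (c : ℂ) (a b : A), (c • a) * b = c • (a * b)
  mul_smul_comm' : ∀ (c : ℂ) (a b : A), a * (c • b) = c • (a * b)
  complete : CompleteSpace A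
  matNorm_one : ∀ x : Matrix (Fin 1) (Fin 1) A, MatrixNormed.matNorm 1 x = ‖x 0 0‖
  approximate_identity : HasContractiveApproximateIdentity A
  exists_representation : ∃ (H : Type u) (_ : NormedAddCommGroup H) (_ : InnerProductSpace ℂ H)
    (_ : CompleteSpace H) (α : A →ₙₐ[ℂ] (H →L[ℂ] H)), IsCompletelyIsometric α

section Concrete

variable {H : Type w₁} [NormedAddCommGroup H] [InnerProductSpace ℂ H] [CompleteSpace H]
  {K : Type w₂} [NormedAddCommGroup K] [InnerProductSpace ℂ K] [CompleteSpace K]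

/-- A `σ`-TRO in `B(H, K)`: a norm closed subspace `M` with `M M* M ⊆ M` and with sequences
`(m_i)`, `(n_i)` in `M` such that `∑ m_i m_i* x = x = ∑ x n_i* n_i` (norm convergence) for
all `x ∈ M`, where all the partial sums of `∑ m_i m_i*` and of `∑ n_i* n_i` are contractions. -/
structure IsSigmaTRO (M : Submodule ℂ (H →L[ℂ] K)) : Prop where
  isClosed : IsClosed (M : Set (H →L[ℂ] K))
  ternary : ∀ x ∈ M, ∀ y ∈ M, ∀ z ∈ M, x ∘L y.adjoint ∘L z ∈ M
  left_unit : ∃ m : ℕ → (H →L[ℂ] K), (∀ i, m i ∈ M) ∧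
    (∀ x ∈ M, Tendsto (fun l => ∑ i ∈ Finset.range l, m i ∘L (m i).adjoint ∘L x) atTop (𝓝 x)) ∧
    ∀ l, ‖∑ i ∈ Finset.range l, m i ∘L (m i).adjoint‖ ≤ 1
  right_unit : ∃ n : ℕ → (H →L[ℂ] K), (∀ i, n i ∈ M) ∧
    (∀ x ∈ M, Tendsto (fun l => ∑ i ∈ Finset.range l, x ∘L (n i).adjoint ∘L n i) atTop (𝓝 x)) ∧
    ∀ l, ‖∑ i ∈ Finset.range l, (n i).adjoint ∘L n i‖ ≤ 1

/-- `A ∼_{σTRO} B` for algebras `A ⊆ B(H)`, `B ⊆ B(K)`: there is a `σ`-TRO `M ⊆ B(H, K)` such that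
`A` is the closed linear span of `M* B M` and `B` is the closed linear span of `M A M*`. -/
def SigmaTROEquiv (A : NonUnitalSubalgebra ℂ (H →L[ℂ] H))
    (B : NonUnitalSubalgebra ℂ (K →L[ℂ] K)) : Prop :=
  ∃ M : Submodule ℂ (H →L[ℂ] K), IsSigmaTRO M ∧
    (A : Set (H →L[ℂ] H)) = closure (Submodule.span ℂ
      {t | ∃ x ∈ M, ∃ b ∈ B, ∃ y ∈ M, t = x.adjoint ∘L b ∘L y} : Set (H →L[ℂ] H)) ∧
    (B : Set (K →L[ℂ] K)) = closure (Submodule.span ℂ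
      {t | ∃ x ∈ M, ∃ a ∈ A, ∃ y ∈ M, t = x ∘L a ∘L y.adjoint} : Set (K →L[ℂ] K))

end Concrete

/-- `A ∼_{σΔ} B`: some completely isometric homomorphic images `α(A) ⊆ B(H)` and `β(B) ⊆ B(K)`,
on Hilbert spaces `H` and `K`, satisfy `α(A) ∼_{σTRO} β(B)`. -/
def SigmaDeltaEquiv
    (A : Type u) [NonUnitalNormedRing A] [NormedSpace ℂ A] [MatrixNormed A]
    (B : Type v) [NonUnitalNormedRing B] [NormedSpace ℂ B] [MatrixNormed B] : Prop :=
  ∃ (H : Type w₁) (_ : NormedAddCommGroup H) (_ : InnerProductSpace ℂ H) (_ : CompleteSpace H)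
    (K : Type w₂) (_ : NormedAddCommGroup K) (_ : InnerProductSpace ℂ K) (_ : CompleteSpace K)
    (α : A →ₙₐ[ℂ] (H →L[ℂ] H)) (β : B →ₙₐ[ℂ] (K →L[ℂ] K)),
    IsCompletelyIsometric α ∧ IsCompletelyIsometric β ∧
      SigmaTROEquiv (NonUnitalAlgHom.range α) (NonUnitalAlgHom.range β)

end StableMaps

end

/-! Fix `α₀`, `β₀` and the σ-TRO `M` witnessing the hypothesis. As `M M* M ⊆ M`, the products `y* x`
with `x, y ∈ M` multiply `α₀(A)` into itself from both sides. Such a multiplication is an operation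
on `A` itself, so it can be carried to any other representation `α`: the multipliers of `α₀(A)` get
a *-representation `π` on `H` (`exists_multiplierAlgebra_representation`). With the left unit
`(m_i)` of `M`, the columns `μ(x) = (π(m_i* x))_i` are operators from `H` to `ℓ²(ℕ, H)`, and `∑ y*
m_i m_i* x → y* x` gives `μ(y)* μ(x) = π(y* x)`. Hence `μ` preserves ternary products
(`exists_ternary_representation`), and the closure of its range is the new σ-TRO.

The representation of `B` has to send `x a y*` to `μ(x) α(a) μ(y)*`. It is the limit `β(b) = lim
∑_{i,j<l} μ(m_i) α(m_i* b m_j) μ(m_j)*`, with `m_i* b m_j` read as an element of `A`. The matrix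
`(m_i* b m_j)` is a compression of `b` by a contractive row; its norm is the same under `α₀` and
under `α`, both being completely isometric; expanding it by the row `(μ(m_i))` is contractive again
(`norm_row_le_one`). So `β` is completely contractive. The same formula with the roles exchanged
recovers `β₀` from `β`, so `β` is completely isometric (`exists_transferred_representation`). -/

noncomputable section

open Filter Topology

namespace StableMaps

/-! ### Operator matrices: limits, compression and expansion by a row. -/

section OperatorMatrixNorms

variable {H : Type w₁} [NormedAddCommGroup H] [InnerProductSpace ℂ H]

/-- Entrywise norm convergence gives strong convergence of the matrices, and norm bounds survive
strong limits. -/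
theorem norm_opMatrix_le_of_tendsto {k : ℕ} {T : ℕ → Matrix (Fin k) (Fin k) (H →L[ℂ] H)}
    {T' : Matrix (Fin k) (Fin k) (H →L[ℂ] H)}
    (hT : ∀ p q, Tendsto (fun l => T l p q) atTop (𝓝 (T' p q))) {C : ℝ} (hC : 0 ≤ C)
    (h : ∀ l, ‖opMatrix (T l)‖ ≤ C) : ‖opMatrix T'‖ ≤ C := by
  refine ContinuousLinearMap.opNorm_le_bound _ hC fun x => ?_
  have hlim : Tendsto (fun l => opMatrix (T l) x) atTop (𝓝 (opMatrix T' x)) := by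
    rw [(PiLp.homeomorph 2 (fun _ : Fin k => H)).isInducing.tendsto_nhds_iff, tendsto_pi_nhds]
    intro p
    simp only [Function.comp_def, PiLp.homeomorph, Homeomorph.homeomorph_mk_coe,
      WithLp.equiv_apply, opMatrix_apply]
    exact tendsto_finsetSum _ fun q _ =>
      ((ContinuousLinearMap.apply ℂ H (x q)).continuous.tendsto _).comp (hT p q)
  exact le_of_tendsto hlim.norm
    (Eventually.of_forall fun l => ContinuousLinearMap.le_of_opNorm_le _ (h l) x)

theorem norm_opMatrix_fin_one (T : Matrix (Fin 1) (Fin 1) (H →L[ℂ] H)) :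
    ‖opMatrix T‖ = ‖T 0 0‖ := by
  have hn : ∀ x : PiLp 2 (fun _ : Fin 1 => H), ‖x‖ = ‖x 0‖ := fun x => by
    rw [PiLp.norm_eq_of_L2]; simp
  apply le_antisymm
  · refine ContinuousLinearMap.opNorm_le_bound _ (norm_nonneg _) fun x => ?_
    rw [hn, hn, opMatrix_apply]
    simpa using (T 0 0).le_opNorm (x 0)
  · refine ContinuousLinearMap.opNorm_le_bound _ (norm_nonneg (opMatrix T)) fun x => ?_
    have := (opMatrix T).le_opNorm (WithLp.toLp 2 fun _ => x)
    rw [hn, hn, opMatrix_apply] at this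
    simpa using this

end OperatorMatrixNorms

section OperatorMatrices

variable {H : Type w₁} [NormedAddCommGroup H] [InnerProductSpace ℂ H] [CompleteSpace H]
  {K : Type w₂} [NormedAddCommGroup K] [InnerProductSpace ℂ K] [CompleteSpace K]

theorem sum_norm_adjoint_sq_le {ι : Type*} (s : Finset ι) (r : ι → (H →L[ℂ] K))
    (hr : ‖∑ i ∈ s, r i ∘L (r i).adjoint‖ ≤ 1) (v : K) :
    ∑ i ∈ s, ‖(r i).adjoint v‖ ^ 2 ≤ ‖v‖ ^ 2 := by
  have h1 : ∑ i ∈ s, ‖(r i).adjoint v‖ ^ 2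
      = RCLike.re (inner ℂ ((∑ i ∈ s, r i ∘L (r i).adjoint) v) v) := by
    rw [sum_apply, sum_inner, map_sum]
    refine Finset.sum_congr rfl fun i _ => ?_
    rw [ContinuousLinearMap.comp_apply, ← ContinuousLinearMap.adjoint_inner_right,
      inner_self_eq_norm_sq]
  rw [h1]
  refine (RCLike.re_le_norm _).trans ((norm_inner_le_norm _ _).trans ?_)
  have h2 : ‖(∑ i ∈ s, r i ∘L (r i).adjoint) v‖ ≤ ‖v‖ := by
    simpa using ContinuousLinearMap.le_of_opNorm_le _ hr v
  nlinarith [norm_nonneg v]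

/-- The operator `K^k → H^(kn)` given by the diagonal amplification of the column
`(r_i^*)_i`. -/
def adjointColumn {n : ℕ} (k : ℕ) (r : Fin n → (H →L[ℂ] K)) :
    PiLp 2 (fun _ : Fin k => K) →L[ℂ] PiLp 2 (fun _ : Fin (k * n) => H) :=
  ((PiLp.continuousLinearEquiv 2 ℂ (fun _ : Fin (k * n) => H)).symm : _ →L[ℂ] _) ∘L
    ContinuousLinearMap.pi fun s =>
      (r (finProdFinEquiv.symm s).2).adjoint ∘L
        PiLp.proj 2 (fun _ : Fin k => K) (finProdFinEquiv.symm s).1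

theorem adjointColumn_apply {n : ℕ} (k : ℕ) (r : Fin n → (H →L[ℂ] K))
    (x : PiLp 2 (fun _ : Fin k => K)) (s : Fin (k * n)) :
    adjointColumn k r x s
      = (r (finProdFinEquiv.symm s).2).adjoint (x (finProdFinEquiv.symm s).1) := by
  simp [adjointColumn]

theorem norm_adjointColumn_le {n : ℕ} (k : ℕ) (r : Fin n → (H →L[ℂ] K))
    (hr : ‖∑ i, r i ∘L (r i).adjoint‖ ≤ 1) : ‖adjointColumn k r‖ ≤ 1 := by
  refine ContinuousLinearMap.opNorm_le_bound _ zero_le_one fun x => ?_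
  rw [one_mul]
  refine le_of_sq_le_sq ?_ (norm_nonneg _)
  rw [PiLp.norm_sq_eq_of_L2, PiLp.norm_sq_eq_of_L2,
    ← finProdFinEquiv.sum_comp, Fintype.sum_prod_type]
  refine Finset.sum_le_sum fun p _ => ?_
  simpa [adjointColumn_apply] using sum_norm_adjoint_sq_le Finset.univ r hr (x p)

theorem adjoint_adjointColumn_apply {n : ℕ} (k : ℕ) (r : Fin n → (H →L[ℂ] K))
    (x : PiLp 2 (fun _ : Fin (k * n) => H)) (p : Fin k) :
    (adjointColumn k r).adjoint x p = ∑ i, r i (x (finProdFinEquiv (p, i))) := by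
  refine ext_inner_right ℂ fun v => ?_
  have h := ContinuousLinearMap.adjoint_inner_left (adjointColumn k r)
    (WithLp.toLp 2 (Pi.single p v)) x
  rw [PiLp.inner_apply, PiLp.inner_apply, Finset.sum_eq_single p, ← finProdFinEquiv.sum_comp,
    Fintype.sum_prod_type, Finset.sum_eq_single p] at h
  · simpa [adjointColumn_apply, sum_inner, ContinuousLinearMap.adjoint_inner_right] using h
  · intro q _ hq
    simp [adjointColumn_apply, hq]
  · simp
  · intro q _ hq
    simp [hq]
  · simp

/-- The matrix over pairs of indices with entries `r_i^* Y_pq r_j`. -/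
def compressMatrix {n k : ℕ} (r : Fin n → (H →L[ℂ] K)) (Y : Matrix (Fin k) (Fin k) (K →L[ℂ] K)) :
    Matrix (Fin (k * n)) (Fin (k * n)) (H →L[ℂ] H) :=
  Matrix.of fun s t => (r (finProdFinEquiv.symm s).2).adjoint ∘L
    Y (finProdFinEquiv.symm s).1 (finProdFinEquiv.symm t).1 ∘L r (finProdFinEquiv.symm t).2

/-- The matrix with entries `∑ r_i Z_(p,i)(q,j) r_j^*`. -/
def expandMatrix {n k : ℕ} (r : Fin n → (H →L[ℂ] K))
    (Z : Matrix (Fin (k * n)) (Fin (k * n)) (H →L[ℂ] H)) :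
    Matrix (Fin k) (Fin k) (K →L[ℂ] K) :=
  Matrix.of fun p q => ∑ i, ∑ j,
    r i ∘L Z (finProdFinEquiv (p, i)) (finProdFinEquiv (q, j)) ∘L (r j).adjoint

/-- Compression and expansion are `C Y C*` and `C* Z C` for a single operator `C`, so both are
contractive at every matrix level once the row is. -/
theorem opMatrix_compressMatrix {n k : ℕ} (r : Fin n → (H →L[ℂ] K))
    (Y : Matrix (Fin k) (Fin k) (K →L[ℂ] K)) :
    opMatrix (compressMatrix r Y)
      = adjointColumn k r ∘L opMatrix Y ∘L (adjointColumn k r).adjoint := by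
  ext x s
  rw [opMatrix_apply, ← finProdFinEquiv.sum_comp, Fintype.sum_prod_type]
  simp only [adjointColumn_apply, opMatrix_apply, adjoint_adjointColumn_apply, compressMatrix,
    Matrix.of_apply, ContinuousLinearMap.comp_apply, Equiv.symm_apply_apply, map_sum]

theorem opMatrix_expandMatrix {n k : ℕ} (r : Fin n → (H →L[ℂ] K))
    (Z : Matrix (Fin (k * n)) (Fin (k * n)) (H →L[ℂ] H)) :
    opMatrix (expandMatrix r Z)
      = (adjointColumn k r).adjoint ∘L opMatrix Z ∘L adjointColumn k r := by
  ext x p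
  simp only [opMatrix_apply, ContinuousLinearMap.comp_apply, adjoint_adjointColumn_apply]
  simp_rw [← finProdFinEquiv.sum_comp (fun t => _), Fintype.sum_prod_type]
  simp only [adjointColumn_apply, expandMatrix, Matrix.of_apply, sum_apply,
    ContinuousLinearMap.comp_apply, Equiv.symm_apply_apply, map_sum]
  rw [Finset.sum_comm]

theorem norm_opMatrix_compressMatrix_le {n k : ℕ} (r : Fin n → (H →L[ℂ] K))
    (hr : ‖∑ i, r i ∘L (r i).adjoint‖ ≤ 1) (Y : Matrix (Fin k) (Fin k) (K →L[ℂ] K)) :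
    ‖opMatrix (compressMatrix r Y)‖ ≤ ‖opMatrix Y‖ := by
  have h1 := norm_adjointColumn_le k r hr
  rw [opMatrix_compressMatrix]
  calc _ ≤ ‖adjointColumn k r‖ * (‖opMatrix Y‖ * ‖(adjointColumn k r).adjoint‖) :=
        (ContinuousLinearMap.opNorm_comp_le _ _).trans (by
          gcongr; exact ContinuousLinearMap.opNorm_comp_le _ _)
    _ ≤ 1 * (‖opMatrix Y‖ * 1) := by
        rw [LinearIsometryEquiv.norm_map]
        gcongr
    _ = _ := by ring

theorem norm_opMatrix_expandMatrix_le {n k : ℕ} (r : Fin n → (H →L[ℂ] K))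
    (hr : ‖∑ i, r i ∘L (r i).adjoint‖ ≤ 1)
    (Z : Matrix (Fin (k * n)) (Fin (k * n)) (H →L[ℂ] H)) :
    ‖opMatrix (expandMatrix r Z)‖ ≤ ‖opMatrix Z‖ := by
  have h1 := norm_adjointColumn_le k r hr
  rw [opMatrix_expandMatrix]
  calc _ ≤ ‖(adjointColumn k r).adjoint‖ * (‖opMatrix Z‖ * ‖adjointColumn k r‖) :=
        (ContinuousLinearMap.opNorm_comp_le _ _).trans (by
          gcongr; exact ContinuousLinearMap.opNorm_comp_le _ _)
    _ ≤ 1 * (‖opMatrix Z‖ * 1) := by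
        rw [LinearIsometryEquiv.norm_map]
        gcongr
    _ = _ := by ring

end OperatorMatrices

/-! ### Convergence of uniformly bounded maps, tested on generators. -/

section Convergence

variable {E : Type*} [NormedAddCommGroup E] [NormedSpace ℂ E]
  {F : Type*} [NormedAddCommGroup F] [NormedSpace ℂ F]

theorem tendsto_of_mem_closure_span {ι : Type*} {l : Filter ι} {T : ι → E →ₗ[ℂ] F}
    {T' : E →ₗ[ℂ] F} {C : ℝ} (hC : 0 ≤ C) (hT : ∀ᶠ i in l, ∀ x, ‖T i x‖ ≤ C * ‖x‖)
    (hT' : ∀ x, ‖T' x‖ ≤ C * ‖x‖) {s : Set E} (hs : ∀ x ∈ s, Tendsto (fun i => T i x) l (𝓝 (T' x)))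
    {x : E} (hx : x ∈ closure (Submodule.span ℂ s : Set E)) :
    Tendsto (fun i => T i x) l (𝓝 (T' x)) := by
  have hspan : ∀ y ∈ Submodule.span ℂ s, Tendsto (fun i => T i y) l (𝓝 (T' y)) := by
    intro y hy
    induction hy using Submodule.span_induction with
    | mem y hy => exact hs y hy
    | zero => simp [tendsto_const_nhds]
    | add y z _ _ hy hz => simpa using hy.add hz
    | smul c y _ hy => simpa using hy.const_smul c
  rw [Metric.tendsto_nhds]
  intro ε hε
  -- `C + 1` in place of `C` keeps the denominator positive when `C = 0`.
  obtain ⟨y, hy, hxy⟩ := Metric.mem_closure_iff.1 hx (ε / (3 * (C + 1))) (by positivity)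
  have hxy' : C * ‖x - y‖ < ε / 3 := by
    rw [dist_eq_norm, lt_div_iff₀ (by positivity)] at hxy
    nlinarith [norm_nonneg (x - y)]
  filter_upwards [hT, (Metric.tendsto_nhds.1 (hspan y hy)) (ε / 3) (by positivity)] with i hi hi'
  rw [dist_eq_norm] at hi' ⊢
  have h1 := hi (x - y)
  have h2 := hT' (x - y)
  calc ‖T i x - T' x‖ = ‖T i (x - y) + (T i y - T' y) - T' (x - y)‖ := by
        congr 1; simp only [map_sub]; abel
    _ ≤ ‖T i (x - y)‖ + ‖T i y - T' y‖ + ‖T' (x - y)‖ :=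
        (norm_sub_le _ _).trans (by gcongr; exact norm_add_le _ _)
    _ < ε := by linarith

/-- The differences `T p - T q` tend to zero along the product filter, so no candidate for the limit
is needed. -/
theorem cauchySeq_of_mem_closure_span {T : ℕ → E →ₗ[ℂ] F} {C : ℝ} (hC : 0 ≤ C)
    (hT : ∀ i x, ‖T i x‖ ≤ C * ‖x‖) {s : Set E} (hs : ∀ x ∈ s, CauchySeq (fun i => T i x))
    {x : E} (hx : x ∈ closure (Submodule.span ℂ s : Set E)) :
    CauchySeq (fun i => T i x) := by
  have h := tendsto_of_mem_closure_span (l := atTop ×ˢ atTop) (T := fun p : ℕ × ℕ => T p.1 - T p.2)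
    (T' := 0) (C := C + C) (by positivity)
    (Eventually.of_forall fun p y => by
      rw [LinearMap.sub_apply, add_mul]
      exact (norm_sub_le _ _).trans (add_le_add (hT _ _) (hT _ _)))
    (fun y => by simp; positivity) (s := s)
    (fun y hy => by
      have := hs y hy
      rw [cauchySeq_iff_tendsto_dist_atTop_0, ← prod_atTop_atTop_eq] at this
      rw [tendsto_iff_norm_sub_tendsto_zero]
      simpa [dist_eq_norm] using this) hx
  rw [cauchySeq_iff_tendsto_dist_atTop_0, ← prod_atTop_atTop_eq]
  rw [tendsto_iff_norm_sub_tendsto_zero] at h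
  simpa [dist_eq_norm] using h

end Convergence

/-! ### The essential subspace of a possibly degenerate representation. -/

section Essential

variable {A : Type u} [NonUnitalNormedRing A] [NormedSpace ℂ A]
  {H : Type w} [NormedAddCommGroup H] [InnerProductSpace ℂ H]

/-- The closed linear span of `α(A)H`. -/
def essentialSubspace (α : A →ₙₐ[ℂ] (H →L[ℂ] H)) : Submodule ℂ H :=
  (Submodule.span ℂ {k | ∃ a h, k = α a h}).topologicalClosure

theorem apply_mem_essentialSubspace (α : A →ₙₐ[ℂ] (H →L[ℂ] H)) (a : A) (h : H) :
    α a h ∈ essentialSubspace α :=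
  Submodule.le_topologicalClosure _ (Submodule.subset_span ⟨a, h, rfl⟩)

theorem continuous_of_contractive {α : A →ₙₐ[ℂ] (H →L[ℂ] H)} (hα : ∀ a, ‖α a‖ ≤ ‖a‖) :
    Continuous α :=
  AddMonoidHomClass.continuous_of_bound α 1 (by simpa using hα)

theorem tendsto_apply_of_mem_essentialSubspace {α : A →ₙₐ[ℂ] (H →L[ℂ] H)}
    (hα : ∀ a, ‖α a‖ ≤ ‖a‖) {l : Filter A} (hl : l.IsApproximateUnit) (hl1 : ∀ᶠ e in l, ‖e‖ ≤ 1)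
    {h : H} (hh : h ∈ essentialSubspace α) : Tendsto (fun e => α e h) l (𝓝 h) := by
  refine tendsto_of_mem_closure_span (T := fun e => (α e : H →ₗ[ℂ] H)) (T' := LinearMap.id)
    zero_le_one ?_ (by simp) ?_ hh
  · filter_upwards [hl1] with e he x
    exact ContinuousLinearMap.le_of_opNorm_le _ ((hα e).trans he) x
  · rintro _ ⟨a, k, rfl⟩
    have h1 := ((ContinuousLinearMap.apply ℂ H k).continuous.comp
      (continuous_of_contractive hα)).tendsto a |>.comp (hl.tendsto_mul_right a)
    simpa [Function.comp_def] using h1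

variable [CompleteSpace H]

instance (α : A →ₙₐ[ℂ] (H →L[ℂ] H)) : CompleteSpace (essentialSubspace α) :=
  (Submodule.isClosed_topologicalClosure _).completeSpace_coe

/-- On the essential subspace `α(e) → 1` strongly, and as the `α(e)` are contractions, `α(e)* → 1`
strongly there too. With `P` the projection onto that subspace, `⟨k, α(a) α(e) h⟩ = ⟨α(e)* P α(a)*
k, h⟩` tends to `⟨P α(a)* k, h⟩ = 0`, while `α(a) α(e) h → α(a) h`. -/
theorem apply_eq_zero_of_mem_orthogonal {α : A →ₙₐ[ℂ] (H →L[ℂ] H)}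
    (hα : ∀ a, ‖α a‖ ≤ ‖a‖) (hai : HasContractiveApproximateIdentity A)
    {h : H} (hh : h ∈ (essentialSubspace α)ᗮ) (a : A) : α a h = 0 := by
  obtain ⟨l, hl, hl1⟩ := hai
  have := hl.neBot
  -- adjoints of the approximate identity converge strongly on the essential subspace
  have hadj : ∀ u ∈ essentialSubspace α, Tendsto (fun e => (α e).adjoint u) l (𝓝 u) := by
    intro u hu
    have h1 := tendsto_apply_of_mem_essentialSubspace hα hl hl1 hu
    -- For a contraction `S`, `‖S* u - u‖² ≤ 2‖u‖² - 2 Re ⟨u, S u⟩`.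
    have h2 : Tendsto (fun e => 2 * ‖u‖ ^ 2 - 2 * RCLike.re (inner ℂ u (α e u))) l (𝓝 0) := by
      have h3 : Tendsto (fun e => RCLike.re (inner ℂ u (α e u))) l (𝓝 (RCLike.re (inner ℂ u u))) :=
        (RCLike.continuous_re.tendsto _).comp (tendsto_const_nhds.inner h1)
      rw [inner_self_eq_norm_sq] at h3
      have h4 := (h3.const_mul 2).const_sub (2 * ‖u‖ ^ 2)
      rwa [sub_self] at h4
    rw [tendsto_iff_norm_sub_tendsto_zero]
    have h4 : Tendsto (fun e => ‖(α e).adjoint u - u‖ ^ 2) l (𝓝 0) := by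
      refine squeeze_zero' (Eventually.of_forall fun e => sq_nonneg _) ?_ h2
      filter_upwards [hl1] with e he
      have h5 : ‖(α e).adjoint u‖ ≤ ‖u‖ := by
        have := ContinuousLinearMap.le_of_opNorm_le (α e).adjoint (c := 1)
          (by rw [LinearIsometryEquiv.norm_map]; exact (hα e).trans he) u
        simpa using this
      rw [@norm_sub_sq ℂ, ContinuousLinearMap.adjoint_inner_left]
      nlinarith [norm_nonneg ((α e).adjoint u)]
    have h6 := h4.sqrt
    simpa [Real.sqrt_sq] using h6
  have hweak : ∀ k, Tendsto (fun e => inner ℂ k (α a (α e h))) l (𝓝 0) := by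
    intro k
    have hP : ∀ e, inner ℂ k (α a (α e h))
        = inner ℂ ((α e).adjoint ((essentialSubspace α).starProjection ((α a).adjoint k))) h := by
      intro e
      rw [ContinuousLinearMap.adjoint_inner_left (α e),
        Submodule.inner_starProjection_left_eq_right,
        Submodule.starProjection_eq_self_iff.2 (apply_mem_essentialSubspace α e h),
        ContinuousLinearMap.adjoint_inner_left (α a)]
    simp_rw [hP]
    have hmem : (essentialSubspace α).starProjection ((α a).adjoint k) ∈ essentialSubspace α :=
      Submodule.starProjection_apply_mem _ _
    have h1 := (hadj _ hmem).inner (𝕜 := ℂ) (tendsto_const_nhds (x := h))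
    rwa [Submodule.inner_right_of_mem_orthogonal hmem hh] at h1
  have hstrong : Tendsto (fun e => α a (α e h)) l (𝓝 (α a h)) := by
    have h1 := ((ContinuousLinearMap.apply ℂ H h).continuous.comp
      (continuous_of_contractive hα)).tendsto a |>.comp (hl.tendsto_mul_left a)
    simpa [Function.comp_def] using h1
  refine ext_inner_left ℂ fun k => ?_
  rw [inner_zero_right]
  exact tendsto_nhds_unique ((tendsto_const_nhds (x := k)).inner (𝕜 := ℂ) hstrong) (hweak k)

/-- The algebraic identities for the multiplier representation are checked in this form. -/
theorem ext_on_essentialSubspace {α : A →ₙₐ[ℂ] (H →L[ℂ] H)} {S T : H →L[ℂ] H}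
    (h1 : ∀ a, S * α a = T * α a) (h2 : ∀ h ∈ (essentialSubspace α)ᗮ, S h = T h) : S = T := by
  have h3 : ∀ h ∈ essentialSubspace α, S h = T h := by
    intro h hh
    refine Set.EqOn.closure (f := S) (g := T) ?_ S.continuous T.continuous hh
    intro k hk
    refine LinearMap.eqOn_span (f := (S : H →ₗ[ℂ] H)) (g := (T : H →ₗ[ℂ] H)) ?_ hk
    rintro _ ⟨a, k, rfl⟩
    exact DFunLike.congr_fun (h1 a) k
  ext h
  have := (essentialSubspace α).starProjection_add_starProjection_orthogonal h
  rw [← this, map_add, map_add, h3 _ (Submodule.starProjection_apply_mem _ _),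
    h2 _ (Submodule.starProjection_apply_mem _ _)]

end Essential

/-! ### Multipliers of `α₀(A)` and their representation on `H`. -/

section Multipliers

variable {A : Type u} [NonUnitalNormedRing A] [NormedSpace ℂ A]
  {H₀ : Type w₁} [NormedAddCommGroup H₀] [InnerProductSpace ℂ H₀]
  {H : Type w} [NormedAddCommGroup H] [InnerProductSpace ℂ H] [CompleteSpace H]

/-- The rule `α(a) h ↦ α(L a) h` is well defined and bounded thanks to the approximate identity:
`L(e) a = L(e a) → L a`, so `∑ α(L a_j) h_j` is the limit of `α(L e)` applied to `∑ α(a_j) h_j`, and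
`‖α(L e)‖ ≤ ‖L e‖ = ‖d α₀(e)‖ ≤ ‖d‖`. -/
theorem exists_extension_of_left_multiplier {α₀ : A →ₙₐ[ℂ] (H₀ →L[ℂ] H₀)}
    (hα₀ : ∀ a, ‖α₀ a‖ = ‖a‖) {α : A →ₙₐ[ℂ] (H →L[ℂ] H)}
    (hα : ∀ a, ‖α a‖ ≤ ‖a‖) (hai : HasContractiveApproximateIdentity A)
    {d : H₀ →L[ℂ] H₀} {L : A → A} (hL : ∀ a, α₀ (L a) = d * α₀ a) :
    ∃ T : H →L[ℂ] H, ‖T‖ ≤ ‖d‖ ∧ (∀ a, T * α a = α (L a)) ∧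
      (∀ h ∈ (essentialSubspace α)ᗮ, T h = 0) ∧ ∀ h, T h ∈ essentialSubspace α := by
  obtain ⟨l, hl, hl1⟩ := hai
  have := hl.neBot
  have hinj : Function.Injective α₀ :=
    (AddMonoidHomClass.isometry_of_norm α₀ hα₀).injective
  let g : (A × H →₀ ℂ) →ₗ[ℂ] H := Finsupp.linearCombination ℂ fun p => α p.1 p.2
  let f : (A × H →₀ ℂ) →ₗ[ℂ] essentialSubspace α := Finsupp.linearCombination ℂ
    fun p => ⟨α (L p.1) p.2, apply_mem_essentialSubspace α _ _⟩
  have hg : ∀ x, g x ∈ essentialSubspace α := by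
    intro x
    refine Submodule.le_topologicalClosure _ ?_
    have h1 : g x ∈ LinearMap.range g := ⟨x, rfl⟩
    rw [Finsupp.range_linearCombination] at h1
    refine Submodule.span_mono ?_ h1
    rintro _ ⟨p, rfl⟩
    exact ⟨_, _, rfl⟩
  let e : (A × H →₀ ℂ) →ₗ[ℂ] essentialSubspace α := g.codRestrict _ hg
  have he : DenseRange e := by
    intro x
    rw [closure_subtype]
    refine closure_mono ?_ x.2
    intro y hy
    have h1 : y ∈ Submodule.span ℂ (Set.range fun p : A × H => α p.1 p.2) := by
      refine Submodule.span_mono ?_ hy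
      rintro _ ⟨a, h, rfl⟩
      exact ⟨(a, h), rfl⟩
    rw [← Finsupp.range_linearCombination] at h1
    obtain ⟨z, hz⟩ := h1
    exact ⟨e z, ⟨z, rfl⟩, hz⟩
  have hmul : ∀ a b, L a * b = L (a * b) := by
    intro a b
    apply hinj
    rw [map_mul, hL, hL, map_mul, mul_assoc]
  have hlim : ∀ x, Tendsto (fun i => α (L i) (g x)) l (𝓝 (f x : H)) := by
    intro x
    induction x using Finsupp.induction_linear with
    | zero => simp
    | add x y hx hy => simpa using hx.add hy
    | single p c =>
      have h1 : Tendsto (fun i => L (i * p.1)) l (𝓝 (L p.1)) := by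
        rw [tendsto_iff_norm_sub_tendsto_zero]
        have h2 := (tendsto_iff_norm_sub_tendsto_zero.1 (hl.tendsto_mul_right p.1)).const_mul ‖d‖
        rw [mul_zero] at h2
        refine squeeze_zero (fun _ => norm_nonneg _) (fun i => ?_) h2
        rw [← hα₀ (L _ - _), ← hα₀ (_ - p.1), map_sub, map_sub, hL, hL, ← mul_sub]
        exact norm_mul_le _ _
      have h3 := (((ContinuousLinearMap.apply ℂ H p.2).continuous.comp
        (continuous_of_contractive hα)).tendsto (L p.1) |>.comp h1).const_smul c
      simpa [Function.comp_def, g, f, ← hmul] using h3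
  have hnorm : ∀ x, ‖f x‖ ≤ ‖d‖ * ‖e x‖ := by
    intro x
    refine le_of_tendsto (hlim x).norm ?_
    filter_upwards [hl1] with i hi
    refine ContinuousLinearMap.le_of_opNorm_le _ ?_ (g x)
    refine (hα _).trans ?_
    rw [← hα₀, hL]
    refine (norm_mul_le _ _).trans ?_
    rw [hα₀]
    exact mul_le_of_le_one_right (norm_nonneg _) hi
  refine ⟨(essentialSubspace α).subtypeL ∘L (f.extendOfNorm e) ∘L
    (essentialSubspace α).orthogonalProjectionOnto, ?_, ?_, ?_, ?_⟩
  · refine ContinuousLinearMap.opNorm_le_bound _ (norm_nonneg _) fun h => ?_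
    have h1 := LinearMap.norm_extendOfNorm_apply_le he _ hnorm
      ((essentialSubspace α).orthogonalProjectionOnto h)
    refine h1.trans ?_
    gcongr
    exact Submodule.norm_orthogonalProjectionOnto_apply_le _ _
  · intro a
    ext h
    have h1 : (essentialSubspace α).orthogonalProjectionOnto (α a h)
        = e (Finsupp.single (a, h) 1) := by
      have : α a h = e (Finsupp.single (a, h) 1) := by simp [e, g]
      rw [this, Submodule.orthogonalProjectionOnto_mem_subspace_eq_self]
    have h2 := LinearMap.extendOfNorm_eq he ⟨_, hnorm⟩ (Finsupp.single (a, h) 1)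
    simp only [mul_apply_eq_comp, ContinuousLinearMap.comp_apply, h1, h2]
    simp [f]
  · intro h hh
    simp [Submodule.orthogonalProjectionOnto_apply_of_mem_orthogonal hh]
  · intro h
    exact Submodule.coe_mem _

variable [CompleteSpace H₀]

/-- The two-sided multipliers in `B(H₀)` of the image of a homomorphism `A → B(H₀)` whose adjoints
are also multipliers. -/
def multiplierAlgebra (α₀ : A →ₙₐ[ℂ] (H₀ →L[ℂ] H₀)) : StarSubalgebra ℂ (H₀ →L[ℂ] H₀) where
  carrier := {d | ∀ a, (∃ b, α₀ b = d * α₀ a) ∧ (∃ b, α₀ b = α₀ a * d) ∧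
    (∃ b, α₀ b = star d * α₀ a) ∧ ∃ b, α₀ b = α₀ a * star d}
  mul_mem' := by
    intro d e hd he a
    obtain ⟨⟨b1, h1⟩, -⟩ := he a
    obtain ⟨⟨c1, g1⟩, -⟩ := hd b1
    obtain ⟨-, ⟨b2, h2⟩, -⟩ := hd a
    obtain ⟨-, ⟨c2, g2⟩, -⟩ := he b2
    obtain ⟨-, -, ⟨b3, h3⟩, -⟩ := hd a
    obtain ⟨-, -, ⟨c3, g3⟩, -⟩ := he b3
    obtain ⟨-, -, -, ⟨b4, h4⟩⟩ := he a
    obtain ⟨-, -, -, ⟨c4, g4⟩⟩ := hd b4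
    exact ⟨⟨c1, by rw [g1, h1, mul_assoc]⟩, ⟨c2, by rw [g2, h2, mul_assoc]⟩,
      ⟨c3, by rw [g3, h3, star_mul, mul_assoc]⟩, ⟨c4, by rw [g4, h4, star_mul, mul_assoc]⟩⟩
  add_mem' := by
    intro d e hd he a
    obtain ⟨⟨b1, h1⟩, ⟨b2, h2⟩, ⟨b3, h3⟩, ⟨b4, h4⟩⟩ := hd a
    obtain ⟨⟨c1, g1⟩, ⟨c2, g2⟩, ⟨c3, g3⟩, ⟨c4, g4⟩⟩ := he a
    exact ⟨⟨b1 + c1, by rw [map_add, h1, g1, add_mul]⟩, ⟨b2 + c2, by rw [map_add, h2, g2, mul_add]⟩,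
      ⟨b3 + c3, by rw [map_add, h3, g3, star_add, add_mul]⟩,
      ⟨b4 + c4, by rw [map_add, h4, g4, star_add, mul_add]⟩⟩
  algebraMap_mem' := by
    intro c a
    rw [Algebra.algebraMap_eq_smul_one]
    exact ⟨⟨c • a, by simp⟩, ⟨c • a, by simp⟩, ⟨star c • a, by simp⟩, ⟨star c • a, by simp⟩⟩
  star_mem' := by
    intro d hd a
    obtain ⟨h1, h2, h3, h4⟩ := hd a
    exact ⟨h3, h4, by rwa [star_star], by rwa [star_star]⟩

end Multipliers

section MultiplierRepresentation

variable {A : Type u} [NonUnitalNormedRing A] [NormedSpace ℂ A]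
  {H₀ : Type w₁} [NormedAddCommGroup H₀] [InnerProductSpace ℂ H₀] [CompleteSpace H₀]
  {H : Type w} [NormedAddCommGroup H] [InnerProductSpace ℂ H] [CompleteSpace H]

theorem exists_eq_add_I_smul {E : Type*} [AddCommGroup E] [Module ℂ E] [StarAddMonoid E]
    [StarModule ℂ E] (d : E) : ∃ x y : E, star x = x ∧ star y = y ∧ d = x + Complex.I • y := by
  refine ⟨realPart d, imaginaryPart d, (realPart d).2.star_eq, (imaginaryPart d).2.star_eq, ?_⟩
  exact (realPart_add_I_smul_imaginaryPart d).symm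

/-- `π d` is left multiplication by `d` on the essential subspace and zero on its complement;
uniqueness makes `π` a homomorphism. It preserves adjoints because it is contractive and `π 1` is
the projection onto the essential subspace. -/
theorem exists_multiplierAlgebra_representation {α₀ : A →ₙₐ[ℂ] (H₀ →L[ℂ] H₀)}
    (hα₀ : ∀ a, ‖α₀ a‖ = ‖a‖) {α : A →ₙₐ[ℂ] (H →L[ℂ] H)}
    (hα : ∀ a, ‖α a‖ ≤ ‖a‖) (hai : HasContractiveApproximateIdentity A) :
    ∃ π : multiplierAlgebra α₀ →⋆ₙₐ[ℂ] (H →L[ℂ] H),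
      (∀ d, ‖π d‖ ≤ ‖(d : H₀ →L[ℂ] H₀)‖) ∧
      (∀ (d : multiplierAlgebra α₀) (a b : A), α₀ b = d * α₀ a → α b = π d * α a) ∧
      ∀ (d : multiplierAlgebra α₀) (a b : A), α₀ b = α₀ a * d → α b = α a * π d := by
  have hinj : Function.Injective α₀ :=
    (AddMonoidHomClass.isometry_of_norm α₀ hα₀).injective
  have hex : ∀ d : multiplierAlgebra α₀, ∃ T : H →L[ℂ] H, ‖T‖ ≤ ‖(d : H₀ →L[ℂ] H₀)‖ ∧
      (∀ a b, α₀ b = d * α₀ a → α b = T * α a) ∧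
      (∀ h ∈ (essentialSubspace α)ᗮ, T h = 0) ∧ ∀ h, T h ∈ essentialSubspace α := by
    intro d
    choose L hL using fun a => (d.2 a).1
    obtain ⟨T, h1, h2, h3⟩ := exists_extension_of_left_multiplier hα₀ hα hai hL
    refine ⟨T, h1, fun a b hab => ?_, h3⟩
    rw [h2, ← hinj (hab.trans (hL a).symm)]
  choose π hnorm hmul hzero hmem using hex
  have hleft : ∀ (d : multiplierAlgebra α₀) a, ∃ b, α₀ b = d * α₀ a := fun d a => (d.2 a).1
  have hadd : ∀ d e, π (d + e) = π d + π e := by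
    intro d e
    refine ext_on_essentialSubspace (α := α) (fun a => ?_) (fun h hh => ?_)
    · obtain ⟨b, hb⟩ := hleft d a
      obtain ⟨c, hc⟩ := hleft e a
      rw [add_mul, ← hmul d a b hb, ← hmul e a c hc, ← map_add]
      refine (hmul _ _ _ ?_).symm
      rw [map_add, hb, hc, ← add_mul]
      rfl
    · rw [hzero _ h hh, add_apply, hzero _ h hh, hzero _ h hh, add_zero]
  have hsmul : ∀ (c : ℂ) d, π (c • d) = c • π d := by
    intro c d
    refine ext_on_essentialSubspace (α := α) (fun a => ?_) (fun h hh => ?_)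
    · obtain ⟨b, hb⟩ := hleft d a
      rw [smul_mul_assoc, ← hmul d a b hb, ← map_smul]
      refine (hmul _ _ _ ?_).symm
      rw [map_smul, hb, ← smul_mul_assoc]
      rfl
    · rw [hzero _ h hh, smul_apply, hzero _ h hh, smul_zero]
  have hmulm : ∀ d e, π (d * e) = π d * π e := by
    intro d e
    refine ext_on_essentialSubspace (α := α) (fun a => ?_) (fun h hh => ?_)
    · obtain ⟨b, hb⟩ := hleft e a
      obtain ⟨c, hc⟩ := hleft d b
      rw [mul_assoc, ← hmul e a b hb, ← hmul d b c hc]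
      refine (hmul _ _ _ ?_).symm
      rw [hc, hb, ← mul_assoc]
      rfl
    · rw [hzero _ h hh, mul_apply_eq_comp, hzero _ h hh, map_zero]
  have hone : π 1 = (essentialSubspace α).starProjection := by
    refine ext_on_essentialSubspace (α := α) (fun a => ?_) (fun h hh => ?_)
    · rw [← hmul 1 a a (by simp)]
      ext h
      exact (Submodule.starProjection_eq_self_iff.2 (apply_mem_essentialSubspace α a h)).symm
    · rw [hzero _ h hh]
      exact ((Submodule.starProjection_apply_eq_zero_iff _).2 hh).symm
  have hmulone : ∀ d h, π d (π 1 h) = π d h := by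
    intro d h
    rw [← mul_apply_eq_comp, ← hmulm, mul_one]
  -- Numerical range argument: `‖1 + i t d‖² ≤ 1 + t²‖d‖²` for real `t` and self-adjoint `d`.
  -- Contractivity passes this to `π d`, and the term linear in `t`, a multiple of `Im ⟨π(1) h, π(d)
  -- h⟩`, must vanish.
  have hself : ∀ d : multiplierAlgebra α₀, star d = d → star (π d) = π d := by
    intro d hd
    have hd' : star (d : H₀ →L[ℂ] H₀) = d := congrArg Subtype.val hd
    have hE : ∀ t : ℝ, ‖(1 + ((t : ℂ) * Complex.I) • (d : H₀ →L[ℂ] H₀))‖ ^ 2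
        ≤ 1 + t ^ 2 * ‖(d : H₀ →L[ℂ] H₀)‖ ^ 2 := by
      intro t
      have h1 : star (1 + ((t : ℂ) * Complex.I) • (d : H₀ →L[ℂ] H₀))
          * (1 + ((t : ℂ) * Complex.I) • (d : H₀ →L[ℂ] H₀))
          = 1 + ((t : ℂ) ^ 2) • ((d : H₀ →L[ℂ] H₀) * d) := by
        have h2 : (star ((t : ℂ) * Complex.I)) = - ((t : ℂ) * Complex.I) := by simp
        rw [star_add, star_one, star_smul, hd', h2, add_mul, mul_add, mul_add, one_mul, one_mul,
          mul_one, smul_mul_smul_comm]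
        have h3 : -((t : ℂ) * Complex.I) * ((t : ℂ) * Complex.I) = (t : ℂ) ^ 2 := by
          linear_combination (-(t : ℂ) ^ 2) * Complex.I_sq
        rw [h3, neg_smul]
        abel
      rw [pow_two, ← CStarRing.norm_star_mul_self, h1]
      refine (norm_add_le _ _).trans (add_le_add ?_ ?_)
      · exact ContinuousLinearMap.norm_id_le
      · rw [norm_smul]
        have h4 : ‖(t : ℂ) ^ 2‖ = t ^ 2 := by simp
        rw [h4, pow_two ‖_‖]
        gcongr
        exact norm_mul_le _ _
    have hreal : ∀ h, (inner ℂ (π 1 h) (π d h)).im = 0 := by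
      intro h
      set c := (inner ℂ (π 1 h) (π d h)).im with hc
      have hle : ∀ t : ℝ, -(2 * t * c) ≤ t ^ 2 * (‖(d : H₀ →L[ℂ] H₀)‖ ^ 2 * ‖π 1 h‖ ^ 2) := by
        intro t
        have h1 : π (1 + ((t : ℂ) * Complex.I) • d) (π 1 h)
            = π 1 h + ((t : ℂ) * Complex.I) • π d h := by
          rw [hadd, hsmul, add_apply, smul_apply, hmulone, hmulone]
        have h2 := (π (1 + ((t : ℂ) * Complex.I) • d)).le_opNorm (π 1 h)
        have h3 : ‖π (1 + ((t : ℂ) * Complex.I) • d) (π 1 h)‖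
            ≤ ‖(1 + ((t : ℂ) * Complex.I) • (d : H₀ →L[ℂ] H₀))‖ * ‖π 1 h‖ :=
          h2.trans (mul_le_mul_of_nonneg_right (hnorm _) (norm_nonneg _))
        have h4 := pow_le_pow_left₀ (norm_nonneg _) h3 2
        rw [h1, mul_pow, @norm_add_sq ℂ, inner_smul_right] at h4
        have h5 := mul_le_mul_of_nonneg_right (hE t) (sq_nonneg ‖π 1 h‖)
        have h6 : RCLike.re ((t : ℂ) * Complex.I * inner ℂ (π 1 h) (π d h)) = -(t * c) := by
          simp [hc]
        rw [h6] at h4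
        nlinarith [sq_nonneg ‖((t : ℂ) * Complex.I) • π d h‖]
      set k := ‖(d : H₀ →L[ℂ] H₀)‖ ^ 2 * ‖π 1 h‖ ^ 2 with hk
      have hk0 : 0 ≤ k := by positivity
      -- With `s = c / (k + 1)` and `t = -s` the inequality reads `2 (k + 1) s² ≤ s² k`, forcing `s
      -- = 0`; `k + 1` avoids division by zero.
      have h7 := hle (-(c / (k + 1)))
      have h8 : -(2 * -(c / (k + 1)) * c) = 2 * (k + 1) * (c / (k + 1)) ^ 2 := by
        field_simp
      rw [h8] at h7
      have h9 : (c / (k + 1)) ^ 2 = 0 := by nlinarith [sq_nonneg (c / (k + 1))]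
      have h10 : c / (k + 1) = 0 := by simpa using h9
      rcases div_eq_zero_iff.1 h10 with h | h
      · exact h
      · linarith
    have hsym : ((π d : H →L[ℂ] H) : H →ₗ[ℂ] H).IsSymmetric := by
      rw [LinearMap.isSymmetric_iff_inner_map_self_real]
      intro h
      rw [Complex.conj_eq_iff_im, ContinuousLinearMap.coe_coe]
      have h1 := hreal h
      rw [hone, Submodule.inner_starProjection_left_eq_right,
        Submodule.starProjection_eq_self_iff.2 (hmem d h)] at h1
      rw [← inner_conj_symm, Complex.conj_im, h1, neg_zero]
    exact (ContinuousLinearMap.isSelfAdjoint_iff_isSymmetric.2 hsym).star_eq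
  have hstar : ∀ d, π (star d) = star (π d) := by
    intro d
    obtain ⟨x, y, hx, hy, rfl⟩ := exists_eq_add_I_smul d
    rw [hadd, hsmul, star_add, star_add, star_smul, star_smul, hx, hy, hself x hx, hself y hy,
      hadd, hsmul]
  refine ⟨{ toFun := π, map_smul' := hsmul, map_zero' := ?_, map_add' := hadd, map_mul' := hmulm,
            map_star' := hstar }, hnorm, hmul, ?_⟩
  · simpa using hsmul 0 0
  · intro d a b hab
    refine ext_on_essentialSubspace (α := α) (fun c => ?_) (fun h hh => ?_)
    -- The identity `(a d) c = a (d c)` in `B(H₀)` becomes `b c = a f` in `A`, by injectivity of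
    -- `α₀`.
    · obtain ⟨f, hf⟩ := hleft d c
      change α b * α c = α a * π d * α c
      rw [mul_assoc, ← hmul d c f hf, ← map_mul, ← map_mul]
      congr 1
      apply hinj
      rw [map_mul, map_mul, hab, hf, mul_assoc]
    · rw [apply_eq_zero_of_mem_orthogonal hα hai hh]
      change 0 = α a (π d h)
      rw [hzero _ h hh, map_zero]

end MultiplierRepresentation

theorem map_mem_closure_span {E : Type*} [NormedAddCommGroup E] [NormedSpace ℂ E]
    {F : Type*} [NormedAddCommGroup F] [NormedSpace ℂ F] (f : E →L[ℂ] F) {s : Set E}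
    {P : Submodule ℂ F} (hP : IsClosed (P : Set F)) (h : ∀ x ∈ s, f x ∈ P)
    {x : E} (hx : x ∈ closure (Submodule.span ℂ s : Set E)) : f x ∈ P := by
  have h1 : Submodule.span ℂ s ≤ P.comap (f : E →ₗ[ℂ] F) := Submodule.span_le.2 h
  exact closure_minimal (s := (Submodule.span ℂ s : Set E)) h1 (hP.preimage f.continuous) hx

/-! ### The ternary morphism `μ` from `M` into `B(H, ℓ²(ℕ, H))`. -/

section TernaryRepresentation

variable {A : Type u} [NonUnitalNormedRing A] [NormedSpace ℂ A]
  {H₀ : Type w₁} [NormedAddCommGroup H₀] [InnerProductSpace ℂ H₀] [CompleteSpace H₀]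
  {K₀ : Type w₂} [NormedAddCommGroup K₀] [InnerProductSpace ℂ K₀] [CompleteSpace K₀]
  {H : Type w} [NormedAddCommGroup H] [InnerProductSpace ℂ H] [CompleteSpace H]

/-- A contractive linear map `μ` on a space of operators which preserves ternary products and is
compatible with homomorphisms `α₀` and `α` of the same algebra `A`: where `y* x` multiplies
`α₀(A)`, the operator `μ(y)* μ(x)` multiplies `α(A)` in the same way. -/
structure IsTernaryExtension {K : Type*} [NormedAddCommGroup K] [InnerProductSpace ℂ K]
    [CompleteSpace K] (α₀ : A →ₙₐ[ℂ] (H₀ →L[ℂ] H₀)) (α : A →ₙₐ[ℂ] (H →L[ℂ] H))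
    {M : Submodule ℂ (H₀ →L[ℂ] K₀)} (μ : M →ₗ[ℂ] (H →L[ℂ] K)) : Prop where
  norm_le : ∀ x, ‖μ x‖ ≤ ‖x‖
  ternary : ∀ x y z w : M, (w : H₀ →L[ℂ] K₀) = x ∘L (y : H₀ →L[ℂ] K₀).adjoint ∘L z →
    μ w = μ x ∘L (μ y).adjoint ∘L μ z
  left_mul : ∀ (x y : M) (a b : A), α₀ b = ((y : H₀ →L[ℂ] K₀).adjoint ∘L x) * α₀ a →
    α b = ((μ y).adjoint ∘L μ x) * α a
  right_mul : ∀ (x y : M) (a b : A), α₀ b = α₀ a * ((y : H₀ →L[ℂ] K₀).adjoint ∘L x) →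
    α b = α a * ((μ y).adjoint ∘L μ x)

theorem sum_norm_sq_apply_eq {ι : Type*} (s : Finset ι) (T : ι → (H →L[ℂ] H)) (h : H) :
    ∑ i ∈ s, ‖T i h‖ ^ 2 = RCLike.re (inner ℂ ((∑ i ∈ s, star (T i) * T i) h) h) := by
  rw [sum_apply, sum_inner, map_sum]
  refine Finset.sum_congr rfl fun i _ => ?_
  rw [mul_apply_eq_comp, ContinuousLinearMap.star_eq_adjoint,
    ContinuousLinearMap.adjoint_inner_left, inner_self_eq_norm_sq]

theorem star_adjoint_comp (x y : H₀ →L[ℂ] K₀) :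
    star (y.adjoint ∘L x) = x.adjoint ∘L y := by
  rw [ContinuousLinearMap.star_eq_adjoint, ContinuousLinearMap.adjoint_comp,
    ContinuousLinearMap.adjoint_adjoint]

-- Here `μ(x) h = (π(m_i* x) h)_i`. It is square summable because the partial sums of squares are
-- `⟨π(x* (∑ m_i m_i*) x) h, h⟩ ≤ ‖x‖² ‖h‖²`. The key identity is `μ(y)* μ(x) = π(y* x)`; it turns
-- the multiplier clauses and the column bound into properties of `π`.
set_option maxHeartbeats 800000 in
theorem exists_ternary_representation {α₀ : A →ₙₐ[ℂ] (H₀ →L[ℂ] H₀)}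
    (hα₀ : ∀ a, ‖α₀ a‖ = ‖a‖) {α : A →ₙₐ[ℂ] (H →L[ℂ] H)}
    (hα : ∀ a, ‖α a‖ ≤ ‖a‖) (hai : HasContractiveApproximateIdentity A)
    {M : Submodule ℂ (H₀ →L[ℂ] K₀)}
    (hmult : ∀ x ∈ M, ∀ y ∈ M, x.adjoint ∘L y ∈ multiplierAlgebra α₀)
    {m : ℕ → (H₀ →L[ℂ] K₀)} (hm : ∀ i, m i ∈ M)
    (hmlim : ∀ x ∈ M,
      Tendsto (fun l => ∑ i ∈ Finset.range l, m i ∘L (m i).adjoint ∘L x) atTop (𝓝 x))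
    (hmnorm : ∀ l, ‖∑ i ∈ Finset.range l, m i ∘L (m i).adjoint‖ ≤ 1) :
    ∃ μ : M →ₗ[ℂ] (H →L[ℂ] lp (fun _ : ℕ => H) 2), IsTernaryExtension α₀ α μ ∧
      ∀ (s : Finset ℕ) (n : ℕ → M),
        ‖∑ i ∈ s, (n i : H₀ →L[ℂ] K₀).adjoint ∘L
          (n i : H₀ →L[ℂ] K₀)‖ ≤ 1 →
        ‖∑ i ∈ s, (μ (n i)).adjoint ∘L μ (n i)‖ ≤ 1 := by
  obtain ⟨π, hπ, hπl, hπr⟩ := exists_multiplierAlgebra_representation hα₀ hα hai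
  let p : M → M → multiplierAlgebra α₀ := fun y x =>
    ⟨(y : H₀ →L[ℂ] K₀).adjoint ∘L x, hmult y y.2 x x.2⟩
  let m' : ℕ → M := fun i => ⟨m i, hm i⟩
  have hstar : ∀ x y, star (p y x) = p x y := by
    intro x y
    exact Subtype.ext (star_adjoint_comp _ _)
  have hadd : ∀ y x x', p y (x + x') = p y x + p y x' := fun y x x' =>
    Subtype.ext (ContinuousLinearMap.comp_add _ _ _)
  have hsmul : ∀ y (c : ℂ) x, p y (c • x) = c • p y x := fun y c x =>
    Subtype.ext (ContinuousLinearMap.comp_smul _ _ _)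
  have hpp : ∀ x y l, ((∑ i ∈ Finset.range l, p y (m' i) * p (m' i) x : multiplierAlgebra α₀) :
      H₀ →L[ℂ] H₀) = (y : H₀ →L[ℂ] K₀).adjoint ∘L
        ((∑ i ∈ Finset.range l, m i ∘L (m i).adjoint) ∘L (x : H₀ →L[ℂ] K₀)) := by
    intro x y l
    rw [AddSubmonoidClass.coe_finsetSum, ContinuousLinearMap.finsetSum_comp,
      ContinuousLinearMap.comp_finsetSum]
    rfl
  have hpart : ∀ x h l, ∑ i ∈ Finset.range l, ‖π (p (m' i) x) h‖ ^ 2 ≤ (‖x‖ * ‖h‖) ^ 2 := by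
    intro x h l
    rw [sum_norm_sq_apply_eq]
    have h1 : ∑ i ∈ Finset.range l, star (π (p (m' i) x)) * π (p (m' i) x)
        = π (∑ i ∈ Finset.range l, p x (m' i) * p (m' i) x) := by
      rw [map_sum]
      refine Finset.sum_congr rfl fun i _ => ?_
      rw [← map_star, hstar, map_mul]
    rw [h1]
    have h2 : ‖π (∑ i ∈ Finset.range l, p x (m' i) * p (m' i) x)‖ ≤ ‖x‖ * (1 * ‖x‖) := by
      refine (hπ _).trans ?_
      rw [hpp]
      refine (ContinuousLinearMap.opNorm_comp_le _ _).trans ?_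
      rw [LinearIsometryEquiv.norm_map]
      refine mul_le_mul_of_nonneg_left ?_ (norm_nonneg _)
      exact (ContinuousLinearMap.opNorm_comp_le _ _).trans
        (mul_le_mul_of_nonneg_right (hmnorm l) (norm_nonneg _))
    refine (RCLike.re_le_norm _).trans ((norm_inner_le_norm _ _).trans ?_)
    have h3 := ContinuousLinearMap.le_of_opNorm_le _ h2 h
    nlinarith [norm_nonneg h]
  have hsummable : ∀ x h, Summable fun i => ‖π (p (m' i) x) h‖ ^ 2 := fun x h =>
    summable_of_sum_range_le (fun _ => sq_nonneg _) (hpart x h)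
  have hmem : ∀ x h, Memℓp (fun i => π (p (m' i) x) h) 2 := fun x h =>
    memℓp_gen (by simpa using hsummable x h)
  have hbound : ∀ x h, ‖(⟨fun i => π (p (m' i) x) h, hmem x h⟩ : lp (fun _ : ℕ => H) 2)‖
      ≤ ‖x‖ * ‖h‖ := by
    intro x h
    refine le_of_sq_le_sq ?_ (by positivity)
    have h1 := lp.norm_rpow_eq_tsum (p := 2) (by norm_num)
      (⟨fun i => π (p (m' i) x) h, hmem x h⟩ : lp (fun _ : ℕ => H) 2)
    simp only [ENNReal.toReal_ofNat, Real.rpow_ofNat] at h1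
    exact h1.le.trans (Real.tsum_le_of_sum_range_le (fun _ => sq_nonneg _) (hpart x h))
  let col : M → (H →L[ℂ] lp (fun _ : ℕ => H) 2) := fun x =>
    LinearMap.mkContinuous
      { toFun := fun h => ⟨fun i => π (p (m' i) x) h, hmem x h⟩
        map_add' := fun h k => by ext i; exact map_add _ h k
        map_smul' := fun c h => by ext i; exact map_smul _ c h } ‖x‖ (hbound x)
  have hcol : ∀ x h i, col x h i = π (p (m' i) x) h := fun x h i => rfl
  let μ : M →ₗ[ℂ] (H →L[ℂ] lp (fun _ : ℕ => H) 2) :=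
    { toFun := col
      map_add' := fun x y => by
        ext h i
        simp [hcol, hadd]
      map_smul' := fun c x => by
        ext h i
        simp [hcol, hsmul] }
  have hμ : ∀ x h i, μ x h i = π (p (m' i) x) h := fun x h i => rfl
  have hcont : Continuous π := AddMonoidHomClass.continuous_of_bound π 1 (by simpa using hπ)
  have hμμ : ∀ x y, (μ y).adjoint ∘L μ x = π (p y x) := by
    intro x y
    ext h
    refine ext_inner_right ℂ fun k => ?_
    rw [ContinuousLinearMap.comp_apply, ContinuousLinearMap.adjoint_inner_left]
    have h1 := (lp.hasSum_inner (𝕜 := ℂ) (μ x h) (μ y k)).tendsto_sum_nat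
    refine tendsto_nhds_unique h1 ?_
    have h2 : Tendsto (fun l => ∑ i ∈ Finset.range l, p y (m' i) * p (m' i) x) atTop
        (𝓝 (p y x)) := by
      rw [tendsto_subtype_rng]
      simp_rw [hpp, ContinuousLinearMap.finsetSum_comp]
      exact ((ContinuousLinearMap.compL ℂ H₀ K₀ H₀
        (y : H₀ →L[ℂ] K₀).adjoint).continuous.tendsto _).comp (hmlim x x.2)
    have h3 := ((ContinuousLinearMap.apply ℂ H h).continuous.comp hcont).tendsto _ |>.comp h2
    refine (h3.inner (𝕜 := ℂ) (tendsto_const_nhds (x := k))).congr fun l => ?_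
    simp only [Function.comp_apply, map_sum, map_mul]
    rw [sum_inner]
    refine Finset.sum_congr rfl fun i _ => ?_
    rw [← hstar y (m' i), map_star]
    exact ContinuousLinearMap.adjoint_inner_left _ _ _
  have hle : ∀ x, ‖μ x‖ ≤ ‖x‖ := fun x =>
    LinearMap.mkContinuous_norm_le _ (norm_nonneg x) (hbound x)
  refine ⟨μ, ⟨hle, ?_, ?_, ?_⟩, ?_⟩
  · intro x y z w hw
    -- Ternary products are compared componentwise: `m_i* (x y* z) = (m_i* x)(y* z)`.
    have hp : ∀ u, p u w = p u x * p y z := by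
      intro u
      apply Subtype.ext
      rw [MulMemClass.coe_mul]
      simp only [p]
      rw [hw, ContinuousLinearMap.mul_def, ContinuousLinearMap.comp_assoc]
    rw [hμμ]
    ext h i
    rw [hμ, hp, map_mul]
    rfl
  · intro x y a b hab
    rw [hμμ]
    exact hπl _ a b hab
  · intro x y a b hab
    rw [hμμ]
    exact hπr _ a b hab
  · intro s n hn
    simp_rw [hμμ]
    rw [← map_sum]
    refine (hπ _).trans ?_
    rwa [AddSubmonoidClass.coe_finsetSum]

end TernaryRepresentation

/-! ### Norms and limits of rows under a ternary morphism. -/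

section RowNorms

variable {A : Type u} [NonUnitalNormedRing A] [NormedSpace ℂ A]
  {H₀ : Type w₁} [NormedAddCommGroup H₀] [InnerProductSpace ℂ H₀] [CompleteSpace H₀]
  {K₀ : Type w₂} [NormedAddCommGroup K₀] [InnerProductSpace ℂ K₀] [CompleteSpace K₀]
  {H : Type*} [NormedAddCommGroup H] [InnerProductSpace ℂ H] [CompleteSpace H]
  {K : Type*} [NormedAddCommGroup K] [InnerProductSpace ℂ K] [CompleteSpace K]
  {M : Submodule ℂ (H₀ →L[ℂ] K₀)} {α₀ : A →ₙₐ[ℂ] (H₀ →L[ℂ] H₀)} {α : A →ₙₐ[ℂ] (H →L[ℂ] H)}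
  {μ : M →ₗ[ℂ] (H →L[ℂ] K)}

/-- For self-adjoint `T`, `‖T ^ (2 ^ n)‖ = ‖T‖ ^ (2 ^ n)`, which is unbounded if `‖T‖ > 1`. -/
theorem isSelfAdjoint_norm_le_one_of_pow_bounded {T : K →L[ℂ] K} (hT : IsSelfAdjoint T) {C : ℝ}
    (hC : ∀ n, ‖T ^ (n + 1)‖ ≤ C) : ‖T‖ ≤ 1 := by
  by_contra! h
  obtain ⟨n, hn⟩ := pow_unbounded_of_one_lt C h
  have h1 : ‖T‖ ^ n ≤ ‖T‖ ^ (2 ^ n) := pow_le_pow_right₀ h.le Nat.lt_two_pow_self.le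
  have h2 : ‖T ^ (2 ^ n)‖ = ‖T‖ ^ (2 ^ n) := congrArg NNReal.toReal (hT.nnnorm_pow_two_pow n)
  have h3 := hC (2 ^ n - 1)
  rw [Nat.sub_add_cancel Nat.one_le_two_pow, h2] at h3
  linarith

/-- Products `μ(x) μ(y)*` are not controlled by multipliers of `A`, so the bound comes from powers.
For `T = ∑ μ(m_i) μ(m_i)*` and `S = ∑ m_j m_j*`, the ternary law gives `T^(n+1) = ∑ μ(S^n m_i)
μ(m_i)*`, which is bounded in `n` since `‖S‖ ≤ 1`. -/
theorem IsTernaryExtension.norm_row_le_one (hμ : IsTernaryExtension α₀ α μ)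
    (hter : ∀ x ∈ M, ∀ y ∈ M, ∀ z ∈ M, x ∘L y.adjoint ∘L z ∈ M) {ι : Type*} (s : Finset ι)
    (m : ι → M) (hm : ‖∑ i ∈ s, (m i : H₀ →L[ℂ] K₀) ∘L (m i : H₀ →L[ℂ] K₀).adjoint‖ ≤ 1) :
    ‖∑ i ∈ s, μ (m i) ∘L (μ (m i)).adjoint‖ ≤ 1 := by
  have hself : IsSelfAdjoint (∑ i ∈ s, μ (m i) ∘L (μ (m i)).adjoint) := by
    rw [IsSelfAdjoint, star_sum]
    refine Finset.sum_congr rfl fun i _ => ?_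
    rw [ContinuousLinearMap.star_eq_adjoint, ContinuousLinearMap.adjoint_comp,
      ContinuousLinearMap.adjoint_adjoint]
  have hpow : ∀ n, ∃ y : ι → M, (∀ i, ‖y i‖ ≤ ‖m i‖) ∧
      (∑ i ∈ s, μ (m i) ∘L (μ (m i)).adjoint) ^ (n + 1)
        = ∑ i ∈ s, μ (y i) ∘L (μ (m i)).adjoint := by
    intro n
    induction n with
    | zero => exact ⟨m, fun _ => le_rfl, by rw [zero_add, pow_one]⟩
    | succ n ih =>
      obtain ⟨y, hy, hyT⟩ := ih
      let z : ι → ι → M := fun i j =>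
        ⟨(m j : H₀ →L[ℂ] K₀) ∘L (m j : H₀ →L[ℂ] K₀).adjoint ∘L (y i : H₀ →L[ℂ] K₀),
          hter _ (m j).2 _ (m j).2 _ (y i).2⟩
      refine ⟨fun i => ∑ j ∈ s, z i j, fun i => ?_, ?_⟩
      · have h1 : ((∑ j ∈ s, z i j : M) : H₀ →L[ℂ] K₀)
            = (∑ j ∈ s, (m j : H₀ →L[ℂ] K₀) ∘L (m j : H₀ →L[ℂ] K₀).adjoint) ∘L
              (y i : H₀ →L[ℂ] K₀) := by
          rw [AddSubmonoidClass.coe_finsetSum, ContinuousLinearMap.finsetSum_comp]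
          rfl
        change ‖((∑ j ∈ s, z i j : M) : H₀ →L[ℂ] K₀)‖ ≤ _
        rw [h1]
        refine (ContinuousLinearMap.opNorm_comp_le _ _).trans ?_
        exact (mul_le_of_le_one_left (norm_nonneg _) hm).trans (hy i)
      · rw [pow_succ', hyT, Finset.mul_sum]
        refine Finset.sum_congr rfl fun i _ => ?_
        rw [map_sum, ContinuousLinearMap.finsetSum_comp, Finset.sum_mul]
        refine Finset.sum_congr rfl fun j _ => ?_
        rw [hμ.ternary (m j) (m j) (y i) (z i j) rfl]
        rfl
  refine isSelfAdjoint_norm_le_one_of_pow_bounded hself (C := ∑ i ∈ s, ‖m i‖ * ‖m i‖) fun n => ?_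
  obtain ⟨y, hy, hyT⟩ := hpow n
  rw [hyT]
  refine norm_sum_le_of_le _ fun i _ => (ContinuousLinearMap.opNorm_comp_le _ _).trans ?_
  rw [LinearIsometryEquiv.norm_map]
  exact mul_le_mul ((hμ.norm_le _).trans (hy i)) (hμ.norm_le _) (norm_nonneg _) (norm_nonneg _)

theorem IsTernaryExtension.continuous (hμ : IsTernaryExtension α₀ α μ) : Continuous μ :=
  AddMonoidHomClass.continuous_of_bound μ 1 (by simpa using hμ.norm_le)

theorem IsTernaryExtension.tendsto_sum_left (hμ : IsTernaryExtension α₀ α μ)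
    (hter : ∀ x ∈ M, ∀ y ∈ M, ∀ z ∈ M, x ∘L y.adjoint ∘L z ∈ M) {m : ℕ → M} {x : M}
    (hm : Tendsto (fun l => ∑ i ∈ Finset.range l, (m i : H₀ →L[ℂ] K₀) ∘L
      (m i : H₀ →L[ℂ] K₀).adjoint ∘L (x : H₀ →L[ℂ] K₀)) atTop (𝓝 (x : H₀ →L[ℂ] K₀))) :
    Tendsto (fun l => ∑ i ∈ Finset.range l, μ (m i) ∘L (μ (m i)).adjoint ∘L μ x) atTop
      (𝓝 (μ x)) := by
  let z : ℕ → M := fun i => ⟨_, hter _ (m i).2 _ (m i).2 _ x.2⟩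
  have h1 : Tendsto (fun l => ∑ i ∈ Finset.range l, z i) atTop (𝓝 x) := by
    rw [tendsto_subtype_rng]
    simpa [z] using hm
  refine ((hμ.continuous.tendsto _).comp h1).congr fun l => ?_
  rw [Function.comp_apply, map_sum]
  exact Finset.sum_congr rfl fun i _ => hμ.ternary (m i) (m i) x (z i) rfl

theorem IsTernaryExtension.tendsto_sum_right (hμ : IsTernaryExtension α₀ α μ)
    (hter : ∀ x ∈ M, ∀ y ∈ M, ∀ z ∈ M, x ∘L y.adjoint ∘L z ∈ M) {n : ℕ → M} {x : M}
    (hn : Tendsto (fun l => ∑ i ∈ Finset.range l, (x : H₀ →L[ℂ] K₀) ∘L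
      (n i : H₀ →L[ℂ] K₀).adjoint ∘L (n i : H₀ →L[ℂ] K₀)) atTop (𝓝 (x : H₀ →L[ℂ] K₀))) :
    Tendsto (fun l => ∑ i ∈ Finset.range l, μ x ∘L (μ (n i)).adjoint ∘L μ (n i)) atTop
      (𝓝 (μ x)) := by
  let z : ℕ → M := fun i => ⟨_, hter _ x.2 _ (n i).2 _ (n i).2⟩
  have h1 : Tendsto (fun l => ∑ i ∈ Finset.range l, z i) atTop (𝓝 x) := by
    rw [tendsto_subtype_rng]
    simpa [z] using hn
  refine ((hμ.continuous.tendsto _).comp h1).congr fun l => ?_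
  rw [Function.comp_apply, map_sum]
  exact Finset.sum_congr rfl fun i _ => hμ.ternary x (n i) (n i) (z i) rfl

end RowNorms

/-! ### Comparison of matrix norms through coefficients in `A`. -/

section RowLinks

variable {A : Type u} [NonUnitalNormedRing A] [NormedSpace ℂ A]
  {B : Type v}
  {H : Type*} [NormedAddCommGroup H] [InnerProductSpace ℂ H] [CompleteSpace H]
  {K : Type*} [NormedAddCommGroup K] [InnerProductSpace ℂ K] [CompleteSpace K]
  {H' : Type*} [NormedAddCommGroup H'] [InnerProductSpace ℂ H'] [CompleteSpace H']
  {K' : Type*} [NormedAddCommGroup K'] [InnerProductSpace ℂ K'] [CompleteSpace K']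
  {α : A →ₙₐ[ℂ] (H →L[ℂ] H)} {α' : A →ₙₐ[ℂ] (H' →L[ℂ] H')}
  {β : B → (K →L[ℂ] K)} {β' : B → (K' →L[ℂ] K')}
  {r : ℕ → (H →L[ℂ] K)} {r' : ℕ → (H' →L[ℂ] K')} {c : ℕ → ℕ → B → A}

/-- The matrix over `A` with entries `c_ij(X_pq)`, where `i, j < l`. -/
def coefficientMatrix (c : ℕ → ℕ → B → A) {k : ℕ} (X : Matrix (Fin k) (Fin k) B) (l : ℕ) :
    Matrix (Fin (k * l)) (Fin (k * l)) A :=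
  Matrix.of fun s t => c (finProdFinEquiv.symm s).2 (finProdFinEquiv.symm t).2
    (X (finProdFinEquiv.symm s).1 (finProdFinEquiv.symm t).1)

theorem expandMatrix_coefficientMatrix_apply {k : ℕ} (X : Matrix (Fin k) (Fin k) B) (l : ℕ)
    (p q : Fin k) :
    expandMatrix (fun i : Fin l => r i) ((coefficientMatrix c X l).map α) p q
      = ∑ i ∈ Finset.range l, ∑ j ∈ Finset.range l,
        r i ∘L α (c i j (X p q)) ∘L (r j).adjoint := by
  simp only [Finset.sum_range, expandMatrix, coefficientMatrix, Matrix.of_apply, Matrix.map_apply,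
    Equiv.symm_apply_apply]

variable [MatrixNormed A]

/-- Complete isometry at all levels enters here: the coefficient matrix lives over `A`, so its norm
may be computed through `α'`, where it is a compression of `X.map β'`, instead of `α`. -/
theorem norm_opMatrix_expandMatrix_coefficientMatrix_le (hα : IsCompletelyIsometric α)
    (hα' : IsCompletelyIsometric α')
    (hr : ∀ l, ‖∑ i ∈ Finset.range l, r i ∘L (r i).adjoint‖ ≤ 1)
    (hr' : ∀ l, ‖∑ i ∈ Finset.range l, r' i ∘L (r' i).adjoint‖ ≤ 1)
    (hc : ∀ i j b, α' (c i j b) = (r' i).adjoint ∘L β' b ∘L r' j)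
    {k : ℕ} (X : Matrix (Fin k) (Fin k) B) (l : ℕ) :
    ‖opMatrix (expandMatrix (fun i : Fin l => r i) ((coefficientMatrix c X l).map α))‖
      ≤ ‖opMatrix (X.map β')‖ := by
  refine (norm_opMatrix_expandMatrix_le _ ?_ _).trans ?_
  · rw [Finset.sum_fin_eq_sum_range]
    convert hr l using 3 with i hi
    simp [Finset.mem_range.1 hi]
  · rw [hα, ← hα']
    have h1 : (coefficientMatrix c X l).map α'
        = compressMatrix (fun i : Fin l => r' i) (X.map β') := by
      ext1 s t
      exact hc _ _ _
    rw [h1]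
    refine norm_opMatrix_compressMatrix_le _ ?_ _
    rw [Finset.sum_fin_eq_sum_range]
    convert hr' l using 3 with i hi
    simp [Finset.mem_range.1 hi]

theorem norm_sum_coefficients_le (hα : IsCompletelyIsometric α)
    (hα' : IsCompletelyIsometric α')
    (hr : ∀ l, ‖∑ i ∈ Finset.range l, r i ∘L (r i).adjoint‖ ≤ 1)
    (hr' : ∀ l, ‖∑ i ∈ Finset.range l, r' i ∘L (r' i).adjoint‖ ≤ 1)
    (hc : ∀ i j b, α' (c i j b) = (r' i).adjoint ∘L β' b ∘L r' j) (b : B) (l : ℕ) :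
    ‖∑ i ∈ Finset.range l, ∑ j ∈ Finset.range l, r i ∘L α (c i j b) ∘L (r j).adjoint‖
      ≤ ‖β' b‖ := by
  have h := norm_opMatrix_expandMatrix_coefficientMatrix_le hα hα' hr hr' hc
    (Matrix.of fun _ _ : Fin 1 => b) l
  rw [norm_opMatrix_fin_one, norm_opMatrix_fin_one] at h
  rwa [expandMatrix_coefficientMatrix_apply] at h

/-- The two representations of `A` enter on an equal footing, so the estimate can be used in both
directions. -/
theorem norm_opMatrix_map_le (hα : IsCompletelyIsometric α) (hα' : IsCompletelyIsometric α')
    (hr : ∀ l, ‖∑ i ∈ Finset.range l, r i ∘L (r i).adjoint‖ ≤ 1)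
    (hr' : ∀ l, ‖∑ i ∈ Finset.range l, r' i ∘L (r' i).adjoint‖ ≤ 1)
    (hc : ∀ i j b, α' (c i j b) = (r' i).adjoint ∘L β' b ∘L r' j)
    (hβ : ∀ b, Tendsto (fun l => ∑ i ∈ Finset.range l, ∑ j ∈ Finset.range l,
      r i ∘L α (c i j b) ∘L (r j).adjoint) atTop (𝓝 (β b)))
    {k : ℕ} (X : Matrix (Fin k) (Fin k) B) :
    ‖opMatrix (X.map β)‖ ≤ ‖opMatrix (X.map β')‖ := by
  refine norm_opMatrix_le_of_tendsto (fun p q => ?_) (norm_nonneg _)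
    (norm_opMatrix_expandMatrix_coefficientMatrix_le hα hα' hr hr' hc X)
  refine (hβ (X p q)).congr fun l => ?_
  rw [expandMatrix_coefficientMatrix_apply]

end RowLinks

theorem IsCompletelyIsometric.norm_eq {A : Type u} [NonUnitalNormedRing A] [NormedSpace ℂ A]
    [MatrixNormed A] [OperatorAlgebra A] {H : Type w} [NormedAddCommGroup H]
    [InnerProductSpace ℂ H] {α : A →ₙₐ[ℂ] (H →L[ℂ] H)} (hα : IsCompletelyIsometric α) (a : A) :
    ‖α a‖ = ‖a‖ := by
  have h := hα 1 (Matrix.of fun _ _ => a)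
  rw [norm_opMatrix_fin_one, OperatorAlgebra.matNorm_one] at h
  exact h

/-- This carries the density of the generators in `α₀(A)` and `β₀(B)` back to `A` and `B`. -/
theorem mem_closure_span_of_map_mem {E : Type*} [NormedAddCommGroup E] [NormedSpace ℂ E]
    {F : Type*} [NormedAddCommGroup F] [NormedSpace ℂ F] (f : E →ₗ[ℂ] F)
    (hf : ∀ x, ‖f x‖ = ‖x‖) {s : Set E} {t : Set F} (hst : t ⊆ f '' s) {x : E}
    (hx : f x ∈ closure (Submodule.span ℂ t : Set F)) :
    x ∈ closure (Submodule.span ℂ s : Set E) := by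
  rw [(AddMonoidHomClass.isometry_of_norm f hf).isEmbedding.isInducing.closure_eq_preimage_closure_image]
  refine closure_mono ?_ hx
  rw [← Submodule.map_coe, ← Submodule.span_image]
  exact Submodule.span_mono hst

/-! ### Construction of the representation `β` of `B`. -/

section TransferredRepresentation

variable {A : Type u} [NonUnitalNormedRing A] [NormedSpace ℂ A]
  {B : Type v} [NonUnitalNormedRing B] [NormedSpace ℂ B]
  {H₀ : Type w₁} [NormedAddCommGroup H₀] [InnerProductSpace ℂ H₀] [CompleteSpace H₀]
  {K₀ : Type w₂} [NormedAddCommGroup K₀] [InnerProductSpace ℂ K₀] [CompleteSpace K₀]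
  {H : Type*} [NormedAddCommGroup H] [InnerProductSpace ℂ H] [CompleteSpace H]
  {K : Type*} [NormedAddCommGroup K] [InnerProductSpace ℂ K] [CompleteSpace K]
  {M : Submodule ℂ (H₀ →L[ℂ] K₀)} {α₀ : A →ₙₐ[ℂ] (H₀ →L[ℂ] H₀)} {α : A →ₙₐ[ℂ] (H →L[ℂ] H)}
  {β₀ : B →ₙₐ[ℂ] (K₀ →L[ℂ] K₀)} {μ : M →ₗ[ℂ] (H →L[ℂ] K)}

theorem IsTernaryExtension.apply_of_eq_mul_mul (hμ : IsTernaryExtension α₀ α μ)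
    (hmult : ∀ x ∈ M, ∀ y ∈ M, x.adjoint ∘L y ∈ multiplierAlgebra α₀)
    (z x y w : M) (a c : A)
    (hc : α₀ c = ((z : H₀ →L[ℂ] K₀).adjoint ∘L (x : H₀ →L[ℂ] K₀)) * α₀ a *
      ((y : H₀ →L[ℂ] K₀).adjoint ∘L (w : H₀ →L[ℂ] K₀))) :
    α c = ((μ z).adjoint ∘L μ x) * α a * ((μ y).adjoint ∘L μ w) := by
  obtain ⟨a₁, ha₁⟩ := (hmult z z.2 x x.2 a).1
  rw [← ha₁] at hc
  rw [hμ.right_mul w y a₁ c hc, hμ.left_mul x z a a₁ ha₁]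

/-- With this trivial extension the expansion formula for `β` also yields the one for `β₀`. -/
theorem isTernaryExtension_subtype (M : Submodule ℂ (H₀ →L[ℂ] K₀)) (α₀ : A →ₙₐ[ℂ] (H₀ →L[ℂ] H₀)) :
    IsTernaryExtension α₀ α₀ M.subtype where
  norm_le _ := le_rfl
  ternary _ _ _ _ h := h
  left_mul _ _ _ _ h := h
  right_mul _ _ _ _ h := h

/-- For `b = x a y*`, the compression is `z* b w = (z* x) a (y* w)`, whose outer factors are
multipliers of `A`. -/
theorem IsTernaryExtension.apply_compression (hμ : IsTernaryExtension α₀ α μ)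
    (hmult : ∀ x ∈ M, ∀ y ∈ M, x.adjoint ∘L y ∈ multiplierAlgebra α₀)
    {L : M → M → B →L[ℂ] A} (hL : ∀ x y b, α₀ (L x y b)
      = (x : H₀ →L[ℂ] K₀).adjoint ∘L β₀ b ∘L (y : H₀ →L[ℂ] K₀))
    (z w : M) {x y : M} {a : A} {b : B}
    (hb : β₀ b = x ∘L α₀ a ∘L (y : H₀ →L[ℂ] K₀).adjoint) :
    α (L z w b) = (μ z).adjoint ∘L (μ x ∘L α a ∘L (μ y).adjoint) ∘L μ w := by
  rw [hμ.apply_of_eq_mul_mul hmult z x y w a (L z w b) (by rw [hL, hb]; rfl)]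
  rfl

/-- On `b = x a y*` the double sum factors as `(∑ μ(m_i) μ(m_i)* μ(x)) α(a) (∑ μ(m_j) μ(m_j)*
μ(y))*`. -/
theorem IsTernaryExtension.tendsto_expansion (hμ : IsTernaryExtension α₀ α μ)
    (hter : ∀ x ∈ M, ∀ y ∈ M, ∀ z ∈ M, x ∘L y.adjoint ∘L z ∈ M)
    (hmult : ∀ x ∈ M, ∀ y ∈ M, x.adjoint ∘L y ∈ multiplierAlgebra α₀)
    {L : M → M → B →L[ℂ] A} (hL : ∀ x y b, α₀ (L x y b)
      = (x : H₀ →L[ℂ] K₀).adjoint ∘L β₀ b ∘L (y : H₀ →L[ℂ] K₀))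
    {m : ℕ → M}
    (hm : ∀ x : M, Tendsto (fun l => ∑ i ∈ Finset.range l, (m i : H₀ →L[ℂ] K₀) ∘L
      (m i : H₀ →L[ℂ] K₀).adjoint ∘L (x : H₀ →L[ℂ] K₀)) atTop (𝓝 (x : H₀ →L[ℂ] K₀)))
    {x y : M} {a : A} {b : B} (hb : β₀ b = x ∘L α₀ a ∘L (y : H₀ →L[ℂ] K₀).adjoint) :
    Tendsto (fun l => ∑ i ∈ Finset.range l, ∑ j ∈ Finset.range l,
      μ (m i) ∘L α (L (m i) (m j) b) ∘L (μ (m j)).adjoint) atTop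
      (𝓝 (μ x ∘L α a ∘L (μ y).adjoint)) := by
  have hlim := fun x : M => hμ.tendsto_sum_left hter (hm x)
  have h1 : Tendsto (fun l => (∑ i ∈ Finset.range l, μ (m i) ∘L (μ (m i)).adjoint ∘L μ x) ∘L
      (α a ∘L (∑ j ∈ Finset.range l, μ (m j) ∘L (μ (m j)).adjoint ∘L μ y).adjoint)) atTop
      (𝓝 (μ x ∘L α a ∘L (μ y).adjoint)) := by
    have h2 : Continuous fun p : (H →L[ℂ] K) × (H →L[ℂ] K) =>
        p.1 ∘L (α a ∘L p.2.adjoint) :=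
      continuous_fst.clm_comp (continuous_const.clm_comp
        (ContinuousLinearMap.adjoint.continuous.comp continuous_snd))
    exact (h2.tendsto (μ x, μ y)).comp ((hlim x).prodMk_nhds (hlim y))
  refine h1.congr fun l => ?_
  rw [ContinuousLinearMap.finsetSum_comp]
  refine Finset.sum_congr rfl fun i _ => ?_
  rw [map_sum, ContinuousLinearMap.comp_finsetSum, ContinuousLinearMap.comp_finsetSum]
  refine Finset.sum_congr rfl fun j _ => ?_
  rw [hμ.apply_compression hmult hL _ _ hb, ContinuousLinearMap.adjoint_comp,
    ContinuousLinearMap.adjoint_comp, ContinuousLinearMap.adjoint_adjoint]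
  rfl

variable [MatrixNormed A] [OperatorAlgebra A] [MatrixNormed B] [OperatorAlgebra B]

/-- The compression `x* b y` becomes an element of `A`, to which any representation of `A` applies.
-/
theorem exists_compression (hα₀ : IsCompletelyIsometric α₀) (hβ₀ : IsCompletelyIsometric β₀)
    (hA : ∀ x ∈ M, ∀ b, ∀ y ∈ M, ∃ a, α₀ a = x.adjoint ∘L β₀ b ∘L y) (x y : M) :
    ∃ L : B →L[ℂ] A, ∀ b, α₀ (L b)
      = (x : H₀ →L[ℂ] K₀).adjoint ∘L β₀ b ∘L (y : H₀ →L[ℂ] K₀) := by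
  have hinj : Function.Injective α₀ :=
    (AddMonoidHomClass.isometry_of_norm α₀ hα₀.norm_eq).injective
  choose L hL using fun b => hA x x.2 b y y.2
  refine ⟨LinearMap.mkContinuous
    { toFun := L
      map_add' := fun b b' => hinj (by
        rw [map_add, hL, hL, hL, map_add, ContinuousLinearMap.add_comp,
          ContinuousLinearMap.comp_add])
      map_smul' := fun c b => hinj (by
        rw [RingHom.id_apply, map_smul, hL, hL, map_smul, ContinuousLinearMap.smul_comp,
          ContinuousLinearMap.comp_smul]) }
    (‖x‖ * ‖y‖) fun b => ?_, hL⟩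
  change ‖L b‖ ≤ _
  rw [← hα₀.norm_eq, hL]
  refine (ContinuousLinearMap.opNorm_comp_le _ _).trans ?_
  rw [LinearIsometryEquiv.norm_map, mul_assoc]
  refine mul_le_mul_of_nonneg_left ?_ (norm_nonneg _)
  refine (ContinuousLinearMap.opNorm_comp_le _ _).trans ?_
  rw [hβ₀.norm_eq, mul_comm]
  rfl

theorem exists_transferred_representation (hα₀ : IsCompletelyIsometric α₀)
    (hβ₀ : IsCompletelyIsometric β₀) (hα : IsCompletelyIsometric α)
    (hμ : IsTernaryExtension α₀ α μ)
    (hter : ∀ x ∈ M, ∀ y ∈ M, ∀ z ∈ M, x ∘L y.adjoint ∘L z ∈ M)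
    (hmult : ∀ x ∈ M, ∀ y ∈ M, x.adjoint ∘L y ∈ multiplierAlgebra α₀)
    (hA : ∀ x ∈ M, ∀ b, ∀ y ∈ M, ∃ a, α₀ a = x.adjoint ∘L β₀ b ∘L y)
    (hB : ∀ b, b ∈ closure (Submodule.span ℂ
      {b : B | ∃ x y : M, ∃ a, β₀ b = x ∘L α₀ a ∘L (y : H₀ →L[ℂ] K₀).adjoint} : Set B))
    {m : ℕ → M}
    (hm : ∀ x : M, Tendsto (fun l => ∑ i ∈ Finset.range l, (m i : H₀ →L[ℂ] K₀) ∘L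
      (m i : H₀ →L[ℂ] K₀).adjoint ∘L (x : H₀ →L[ℂ] K₀)) atTop (𝓝 (x : H₀ →L[ℂ] K₀)))
    (hmnorm : ∀ l, ‖∑ i ∈ Finset.range l,
      (m i : H₀ →L[ℂ] K₀) ∘L (m i : H₀ →L[ℂ] K₀).adjoint‖ ≤ 1) :
    ∃ β : B →ₙₐ[ℂ] (K →L[ℂ] K), IsCompletelyIsometric β ∧
      (∀ (x y : M) (a : A) (b : B),
        β₀ b = x ∘L α₀ a ∘L (y : H₀ →L[ℂ] K₀).adjoint → β b = μ x ∘L α a ∘L (μ y).adjoint) ∧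
      ∀ (x y : M) (a : A) (b : B),
        α₀ a = (x : H₀ →L[ℂ] K₀).adjoint ∘L β₀ b ∘L y → α a = (μ x).adjoint ∘L β b ∘L μ y := by
  have hinjα : Function.Injective α₀ :=
    (AddMonoidHomClass.isometry_of_norm α₀ hα₀.norm_eq).injective
  have hinjβ : Function.Injective β₀ :=
    (AddMonoidHomClass.isometry_of_norm β₀ hβ₀.norm_eq).injective
  have hαcont : Continuous α := continuous_of_contractive fun a => (hα.norm_eq a).le
  choose L hL using exists_compression hα₀ hβ₀ hA
  have hrow := fun l => hμ.norm_row_le_one hter (Finset.range l) m (hmnorm l)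
  let β' : ℕ → B →ₗ[ℂ] (K →L[ℂ] K) := fun l =>
    { toFun := fun b => ∑ i ∈ Finset.range l, ∑ j ∈ Finset.range l,
        μ (m i) ∘L α (L (m i) (m j) b) ∘L (μ (m j)).adjoint
      map_add' := fun b b' => by
        simp only [map_add, ContinuousLinearMap.add_comp, ContinuousLinearMap.comp_add,
          Finset.sum_add_distrib]
      map_smul' := fun c b => by
        simp only [map_smul, ContinuousLinearMap.smul_comp, ContinuousLinearMap.comp_smul,
          Finset.smul_sum, RingHom.id_apply] }
  have hβ'_def : ∀ l b, β' l b = ∑ i ∈ Finset.range l, ∑ j ∈ Finset.range l,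
      μ (m i) ∘L α (L (m i) (m j) b) ∘L (μ (m j)).adjoint := fun _ _ => rfl
  have hβ'_norm : ∀ l b, ‖β' l b‖ ≤ 1 * ‖b‖ := by
    intro l b
    rw [one_mul, ← hβ₀.norm_eq b]
    exact norm_sum_coefficients_le (c := fun i j b => L (m i) (m j) b) (β' := β₀) hα hα₀ hrow hmnorm
      (fun i j b => hL _ _ b) b l
  have hgen : ∀ (x y : M) (a : A) (b : B), β₀ b = x ∘L α₀ a ∘L (y : H₀ →L[ℂ] K₀).adjoint →
      Tendsto (fun l => β' l b) atTop (𝓝 (μ x ∘L α a ∘L (μ y).adjoint)) := fun x y a b hb =>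
    hμ.tendsto_expansion hter hmult hL hm hb
  have hconv : ∀ b, ∃ T, Tendsto (fun l => β' l b) atTop (𝓝 T) := fun b =>
    cauchySeq_tendsto_of_complete (cauchySeq_of_mem_closure_span zero_le_one hβ'_norm
      (by rintro b' ⟨x, y, a, hb'⟩; exact (hgen x y a b' hb').cauchySeq) (hB b))
  choose β hβ using hconv
  have hβgen : ∀ (x y : M) (a : A) (b : B), β₀ b = x ∘L α₀ a ∘L (y : H₀ →L[ℂ] K₀).adjoint →
      β b = μ x ∘L α a ∘L (μ y).adjoint := fun x y a b hb =>
    tendsto_nhds_unique (hβ b) (hgen x y a b hb)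
  have hadd : ∀ b b', β (b + b') = β b + β b' := fun b b' =>
    tendsto_nhds_unique (hβ _) (((hβ b).add (hβ b')).congr fun l => (map_add (β' l) b b').symm)
  have hsmul : ∀ (c : ℂ) b, β (c • b) = c • β b := fun c b =>
    tendsto_nhds_unique (hβ _) (((hβ b).const_smul c).congr fun l => (map_smul (β' l) c b).symm)
  let βL : B →L[ℂ] (K →L[ℂ] K) := LinearMap.mkContinuous
    { toFun := β, map_add' := hadd, map_smul' := hsmul } 1 fun b =>
      le_of_tendsto (hβ b).norm (Eventually.of_forall fun l => hβ'_norm l b)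
  have hβcont : Continuous β := βL.continuous
  have hdense : Dense (Submodule.span ℂ
      {b : B | ∃ x y : M, ∃ a, β₀ b = x ∘L α₀ a ∘L (y : H₀ →L[ℂ] K₀).adjoint} : Set B) := hB
  -- Both sides are continuous and linear in `b` and agree on generators. This makes the
  -- compressions of `β(b)` have the same coefficients in `A` as those of `β₀(b)`.
  have hαL : ∀ (z w : M) b, α (L z w b) = (μ z).adjoint ∘L β b ∘L μ w := by
    intro z w b
    let f : B →L[ℂ] (H →L[ℂ] H) := (LinearMap.mkContinuous (α : A →ₗ[ℂ] (H →L[ℂ] H)) 1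
      fun a => by rw [one_mul]; exact (hα.norm_eq a).le) ∘L L z w
    let g : B →L[ℂ] (H →L[ℂ] H) := (ContinuousLinearMap.compL ℂ H K H (μ z).adjoint) ∘L
      ((ContinuousLinearMap.compL ℂ H K K).flip (μ w)) ∘L βL
    have hfg : f = g := by
      refine ContinuousLinearMap.ext_on hdense ?_
      rintro b' ⟨x, y, a, hb'⟩
      change α (L z w b') = (μ z).adjoint ∘L β b' ∘L μ w
      rw [hμ.apply_compression hmult hL z w hb', hβgen x y a b' hb']
    exact DFunLike.congr_fun hfg b
  have hmul : ∀ b b', β (b * b') = β b * β b' := by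
    -- Density of the generators `x a y*` as an induction principle, used in each factor separately.
    have hind : ∀ p : B → Prop, IsClosed {b | p b} → (∀ b b', p b → p b' → p (b + b')) →
        (∀ (c : ℂ) b, p b → p (c • b)) → p 0 →
        (∀ (x y : M) (a : A) (b : B), β₀ b = x ∘L α₀ a ∘L (y : H₀ →L[ℂ] K₀).adjoint → p b) →
        ∀ b, p b := by
      intro p hpc hpa hps hp0 hpg b
      let P : Submodule ℂ B :=
        { carrier := {b | p b}, add_mem' := hpa _ _, smul_mem' := hps, zero_mem' := hp0 }
      exact map_mem_closure_span (ContinuousLinearMap.id ℂ B) (P := P) hpc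
        (by rintro b ⟨x, y, a, hb⟩; exact hpg x y a b hb) (hB b)
    have hβ0 : β 0 = 0 := by simpa using hsmul 0 0
    intro b
    refine hind _ (isClosed_eq (by fun_prop) (by fun_prop)) ?_ ?_ ?_ ?_
    · intro b₁ b₂ h1 h2
      rw [mul_add, hadd, h1, h2, hadd, mul_add]
    · intro c b₁ h1
      rw [OperatorAlgebra.mul_smul_comm', hsmul, h1, hsmul, mul_smul_comm]
    · rw [mul_zero, hβ0, mul_zero]
    · intro x' y' a' b' hb'
      revert b
      refine hind _ (isClosed_eq (by fun_prop) (by fun_prop)) ?_ ?_ ?_ ?_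
      · intro b₁ b₂ h1 h2
        rw [add_mul, hadd, h1, h2, hadd, add_mul]
      · intro c b₁ h1
        rw [OperatorAlgebra.smul_mul_assoc', hsmul, h1, hsmul, smul_mul_assoc]
      · rw [zero_mul, hβ0, zero_mul]
      · intro x y a b hb
        -- `(x a y*)(x' a' y'*) = x (a a₁) y'*`, where `a₁ = y* x' a'` lies in `A`.
        obtain ⟨a₁, ha₁⟩ := (hmult y y.2 x' x'.2 a').1
        rw [hβgen x y a b hb, hβgen x' y' a' b' hb',
          hβgen x y' (a * a₁) (b * b') (by rw [map_mul, hb, hb', map_mul, ha₁]; rfl), map_mul,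
          hμ.left_mul x' y a' a₁ ha₁]
        rfl
  have hαL' : ∀ (x y : M) (a : A) (b : B),
      α₀ a = (x : H₀ →L[ℂ] K₀).adjoint ∘L β₀ b ∘L y → α a = (μ x).adjoint ∘L β b ∘L μ y := by
    intro x y a b hab
    rw [← hαL, hinjα (hab.trans (hL x y b).symm)]
  refine ⟨{ toFun := β, map_smul' := hsmul, map_zero' := by simpa using hsmul 0 0,
            map_add' := hadd, map_mul' := hmul }, ?_, hβgen, hαL'⟩
  intro k X
  rw [← hβ₀ k X]
  have hβ₀lim : ∀ b, Tendsto (fun l => ∑ i ∈ Finset.range l, ∑ j ∈ Finset.range l,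
      (m i : H₀ →L[ℂ] K₀) ∘L α₀ (L (m i) (m j) b) ∘L (m j : H₀ →L[ℂ] K₀).adjoint) atTop
      (𝓝 (β₀ b)) := by
    intro b
    let E : ℕ → B →ₗ[ℂ] (K₀ →L[ℂ] K₀) := fun l =>
      { toFun := fun b => ∑ i ∈ Finset.range l, ∑ j ∈ Finset.range l,
          (m i : H₀ →L[ℂ] K₀) ∘L α₀ (L (m i) (m j) b) ∘L (m j : H₀ →L[ℂ] K₀).adjoint
        map_add' := fun b b' => by
          simp only [map_add, ContinuousLinearMap.add_comp, ContinuousLinearMap.comp_add,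
            Finset.sum_add_distrib]
        map_smul' := fun c b => by
          simp only [map_smul, ContinuousLinearMap.smul_comp, ContinuousLinearMap.comp_smul,
            Finset.smul_sum, RingHom.id_apply] }
    refine tendsto_of_mem_closure_span (T := E) (T' := (β₀ : B →ₗ[ℂ] (K₀ →L[ℂ] K₀)))
      zero_le_one (Eventually.of_forall fun l b => ?_) (fun b => ?_) ?_ (hB b)
    · rw [one_mul, ← hβ₀.norm_eq b]
      exact norm_sum_coefficients_le (c := fun i j b => L (m i) (m j) b) (β' := β₀) hα₀ hα₀
        hmnorm hmnorm (fun i j b => hL _ _ b) b l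
    · rw [one_mul]
      exact (hβ₀.norm_eq b).le
    · rintro b' ⟨x, y, a, hb'⟩
      have h := (isTernaryExtension_subtype M α₀).tendsto_expansion hter hmult hL hm hb'
      change Tendsto _ _ (𝓝 (β₀ b'))
      rw [hb']
      exact h
  apply le_antisymm
  · exact norm_opMatrix_map_le (c := fun i j b => L (m i) (m j) b) (β := β) (β' := β₀) hα hα₀
      hrow hmnorm (fun i j b => hL _ _ b) hβ X
  -- Roles exchanged: compress `β` by the row `(μ(m_i))`, then expand by `(m_i)` to reach `β₀`.
  · exact norm_opMatrix_map_le (c := fun i j b => L (m i) (m j) b) (β := β₀) (β' := β) hα₀ hα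
      hmnorm hrow (fun i j b => hαL _ _ b) hβ₀lim X

end TransferredRepresentation

/-! ### Closed ranges and the σ-TRO generated by `μ`. -/

section IsometricRange

variable {A : Type u} [NonUnitalNormedRing A] [NormedSpace ℂ A] [CompleteSpace A]
  {H : Type*} [NormedAddCommGroup H] [InnerProductSpace ℂ H]

theorem isClosed_range_of_norm_eq (f : A →ₙₐ[ℂ] (H →L[ℂ] H)) (hf : ∀ x, ‖f x‖ = ‖x‖) :
    IsClosed (NonUnitalAlgHom.range f : Set (H →L[ℂ] H)) := by
  rw [NonUnitalAlgHom.coe_range]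
  exact (AddMonoidHomClass.isometry_of_norm f hf).isClosedEmbedding.isClosed_range

theorem range_eq_closure_span (f : A →ₙₐ[ℂ] (H →L[ℂ] H)) (hf : ∀ x, ‖f x‖ = ‖x‖)
    {s : Set A} {t : Set (H →L[ℂ] H)}
    (hs : ∀ x, x ∈ closure (Submodule.span ℂ s : Set A)) (hst : ∀ x ∈ s, f x ∈ t)
    (ht : t ⊆ NonUnitalAlgHom.range f) :
    (NonUnitalAlgHom.range f : Set (H →L[ℂ] H))
      = closure (Submodule.span ℂ t : Set (H →L[ℂ] H)) := by
  apply Set.Subset.antisymm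
  · rintro _ ⟨x, rfl⟩
    let g : A →L[ℂ] (H →L[ℂ] H) := LinearMap.mkContinuous (f : A →ₗ[ℂ] (H →L[ℂ] H)) 1 fun x => by
      rw [one_mul]; exact (hf x).le
    exact map_mem_closure_span g (P := (Submodule.span ℂ t).topologicalClosure)
      (Submodule.isClosed_topologicalClosure _)
      (fun y hy => Submodule.le_topologicalClosure _ (Submodule.subset_span (hst y hy))) (hs x)
  · have h1 : Submodule.span ℂ t ≤ (NonUnitalAlgHom.range f).toSubmodule := Submodule.span_le.2 ht
    exact closure_minimal (s := (Submodule.span ℂ t : Set (H →L[ℂ] H))) h1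
      (isClosed_range_of_norm_eq f hf)

end IsometricRange

section ClosureOfTernaryImage

variable {A : Type u} [NonUnitalNormedRing A] [NormedSpace ℂ A]
  {H₀ : Type w₁} [NormedAddCommGroup H₀] [InnerProductSpace ℂ H₀] [CompleteSpace H₀]
  {K₀ : Type w₂} [NormedAddCommGroup K₀] [InnerProductSpace ℂ K₀] [CompleteSpace K₀]
  {H : Type*} [NormedAddCommGroup H] [InnerProductSpace ℂ H] [CompleteSpace H]
  {K : Type*} [NormedAddCommGroup K] [InnerProductSpace ℂ K] [CompleteSpace K]
  {M : Submodule ℂ (H₀ →L[ℂ] K₀)} {α₀ : A →ₙₐ[ℂ] (H₀ →L[ℂ] H₀)} {α : A →ₙₐ[ℂ] (H →L[ℂ] H)}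
  {μ : M →ₗ[ℂ] (H →L[ℂ] K)}

/-- The units are the images under `μ` of those of `M`; their contractive partial sums extend the
limits from the range to its closure. Passing to the closure avoids proving that the range is
closed. -/
theorem IsTernaryExtension.isSigmaTRO_closure_range (hμ : IsTernaryExtension α₀ α μ)
    (hM : IsSigmaTRO M)
    (hright : ∀ (s : Finset ℕ) (n : ℕ → M),
      ‖∑ i ∈ s, (n i : H₀ →L[ℂ] K₀).adjoint ∘L (n i : H₀ →L[ℂ] K₀)‖ ≤ 1 →
      ‖∑ i ∈ s, (μ (n i)).adjoint ∘L μ (n i)‖ ≤ 1) :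
    IsSigmaTRO (LinearMap.range μ).topologicalClosure where
  isClosed := Submodule.isClosed_topologicalClosure _
  ternary := by
    intro x hx y hy z hz
    have hcont : Continuous fun p : (H →L[ℂ] K) × (H →L[ℂ] K) × (H →L[ℂ] K) =>
        p.1 ∘L p.2.1.adjoint ∘L p.2.2 :=
      continuous_fst.clm_comp ((ContinuousLinearMap.adjoint.continuous.comp
        (continuous_fst.comp continuous_snd)).clm_comp (continuous_snd.comp continuous_snd))
    have hmem : (x, y, z) ∈ closure ((LinearMap.range μ : Set (H →L[ℂ] K)) ×ˢ
        ((LinearMap.range μ : Set (H →L[ℂ] K)) ×ˢ (LinearMap.range μ : Set (H →L[ℂ] K)))) := by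
      rw [closure_prod_eq, closure_prod_eq]
      exact ⟨hx, hy, hz⟩
    refine map_mem_closure (f := fun p : (H →L[ℂ] K) × (H →L[ℂ] K) × (H →L[ℂ] K) =>
      p.1 ∘L p.2.1.adjoint ∘L p.2.2) hcont hmem ?_
    rintro ⟨_, _, _⟩ ⟨⟨x, rfl⟩, ⟨y, rfl⟩, ⟨z, rfl⟩⟩
    exact ⟨⟨_, hM.ternary _ x.2 _ y.2 _ z.2⟩, hμ.ternary x y z _ rfl⟩
  left_unit := by
    obtain ⟨m, hm, hmlim, hmnorm⟩ := hM.left_unit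
    have hrow := fun l => hμ.norm_row_le_one hM.ternary (Finset.range l)
      (fun i => (⟨m i, hm i⟩ : M)) (hmnorm l)
    refine ⟨fun i => μ ⟨m i, hm i⟩, fun i => Submodule.le_topologicalClosure _ ⟨_, rfl⟩,
      fun x hx => ?_, hrow⟩
    have h1 := tendsto_of_mem_closure_span (l := atTop)
      (T := fun l => ((ContinuousLinearMap.compL ℂ H K K
        (∑ i ∈ Finset.range l, μ ⟨m i, hm i⟩ ∘L (μ ⟨m i, hm i⟩).adjoint) :
          (H →L[ℂ] K) →L[ℂ] (H →L[ℂ] K)) : (H →L[ℂ] K) →ₗ[ℂ] (H →L[ℂ] K)))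
      (T' := LinearMap.id) zero_le_one
      (Eventually.of_forall fun l y => (ContinuousLinearMap.opNorm_comp_le _ _).trans
        (mul_le_mul_of_nonneg_right (hrow l) (norm_nonneg y))) (by simp)
      (s := LinearMap.range μ) (by
        rintro _ ⟨y, rfl⟩
        refine (hμ.tendsto_sum_left hM.ternary (m := fun i => ⟨m i, hm i⟩) (hmlim y y.2)).congr
          fun l => ?_
        symm
        exact ContinuousLinearMap.finsetSum_comp _ _)
      (x := x) (by rwa [Submodule.span_eq])
    refine h1.congr fun l => ?_
    exact ContinuousLinearMap.finsetSum_comp _ _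
  right_unit := by
    obtain ⟨n, hn, hnlim, hnnorm⟩ := hM.right_unit
    have hcol := fun l => hright (Finset.range l) (fun i => (⟨n i, hn i⟩ : M)) (hnnorm l)
    refine ⟨fun i => μ ⟨n i, hn i⟩, fun i => Submodule.le_topologicalClosure _ ⟨_, rfl⟩,
      fun x hx => ?_, hcol⟩
    have h1 := tendsto_of_mem_closure_span (l := atTop)
      (T := fun l => (((ContinuousLinearMap.compL ℂ H H K).flip
        (∑ i ∈ Finset.range l, (μ ⟨n i, hn i⟩).adjoint ∘L μ ⟨n i, hn i⟩) :
          (H →L[ℂ] K) →L[ℂ] (H →L[ℂ] K)) : (H →L[ℂ] K) →ₗ[ℂ] (H →L[ℂ] K)))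
      (T' := LinearMap.id) zero_le_one
      (Eventually.of_forall fun l y => (ContinuousLinearMap.opNorm_comp_le _ _).trans (by
        rw [mul_comm]
        exact mul_le_mul_of_nonneg_right (hcol l) (norm_nonneg y))) (by simp)
      (s := LinearMap.range μ) (by
        rintro _ ⟨y, rfl⟩
        refine (hμ.tendsto_sum_right hM.ternary (n := fun i => ⟨n i, hn i⟩) (hnlim y y.2)).congr
          fun l => ?_
        symm
        exact ContinuousLinearMap.comp_finsetSum _ _)
      (x := x) (by rwa [Submodule.span_eq])
    refine h1.congr fun l => ?_
    exact ContinuousLinearMap.comp_finsetSum _ _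

end ClosureOfTernaryImage

/-! ### Elements of `M* M` as multipliers. -/

section Multipliers

variable {A : Type u} [NonUnitalNormedRing A] [NormedSpace ℂ A]
  {H₀ : Type w₁} [NormedAddCommGroup H₀] [InnerProductSpace ℂ H₀] [CompleteSpace H₀]
  {K₀ : Type w₂} [NormedAddCommGroup K₀] [InnerProductSpace ℂ K₀] [CompleteSpace K₀]
  {M : Submodule ℂ (H₀ →L[ℂ] K₀)} {α₀ : A →ₙₐ[ℂ] (H₀ →L[ℂ] H₀)}
  {S : NonUnitalSubalgebra ℂ (K₀ →L[ℂ] K₀)}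

/-- On generators, `(x* y)(u* b v) = (u y* x)* b v` with `u y* x ∈ M`, and similarly on the right;
taking adjoints only swaps `x` and `y`. -/
theorem adjoint_comp_mem_multiplierAlgebra
    (hter : ∀ x ∈ M, ∀ y ∈ M, ∀ z ∈ M, x ∘L y.adjoint ∘L z ∈ M)
    (hA : (NonUnitalAlgHom.range α₀ : Set (H₀ →L[ℂ] H₀)) = closure (Submodule.span ℂ
      {t | ∃ x ∈ M, ∃ b ∈ S, ∃ y ∈ M, t = x.adjoint ∘L b ∘L y} : Set (H₀ →L[ℂ] H₀)))
    {x y : H₀ →L[ℂ] K₀} (hx : x ∈ M) (hy : y ∈ M) :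
    x.adjoint ∘L y ∈ multiplierAlgebra α₀ := by
  let G : Set (H₀ →L[ℂ] H₀) := {t | ∃ x ∈ M, ∃ b ∈ S, ∃ y ∈ M, t = x.adjoint ∘L b ∘L y}
  have hmem : ∀ t, t ∈ (Submodule.span ℂ G).topologicalClosure → ∃ b, α₀ b = t := by
    intro t ht
    have h1 : t ∈ (NonUnitalAlgHom.range α₀ : Set (H₀ →L[ℂ] H₀)) := by
      rw [hA]
      exact ht
    exact h1
  have hclosure : ∀ a, α₀ a ∈ closure (Submodule.span ℂ G : Set (H₀ →L[ℂ] H₀)) := by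
    intro a
    rw [← hA]
    exact ⟨a, rfl⟩
  have hleft : ∀ x ∈ M, ∀ y ∈ M, ∀ a, ∃ b, α₀ b = (x.adjoint ∘L y) * α₀ a := by
    intro x hx y hy a
    refine hmem _ (map_mem_closure_span (ContinuousLinearMap.compL ℂ H₀ H₀ H₀ (x.adjoint ∘L y))
      (Submodule.isClosed_topologicalClosure _) ?_ (hclosure a))
    rintro _ ⟨u, hu, b, hb, v, hv, rfl⟩
    refine Submodule.le_topologicalClosure _ (Submodule.subset_span
      ⟨u ∘L y.adjoint ∘L x, hter u hu y hy x hx, b, hb, v, hv, ?_⟩)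
    rw [ContinuousLinearMap.adjoint_comp, ContinuousLinearMap.adjoint_comp,
      ContinuousLinearMap.adjoint_adjoint]
    rfl
  have hright : ∀ x ∈ M, ∀ y ∈ M, ∀ a, ∃ b, α₀ b = α₀ a * (x.adjoint ∘L y) := by
    intro x hx y hy a
    refine hmem _ (map_mem_closure_span
      ((ContinuousLinearMap.compL ℂ H₀ H₀ H₀).flip (x.adjoint ∘L y))
      (Submodule.isClosed_topologicalClosure _) ?_ (hclosure a))
    rintro _ ⟨u, hu, b, hb, v, hv, rfl⟩
    exact Submodule.le_topologicalClosure _ (Submodule.subset_span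
      ⟨u, hu, b, hb, v ∘L x.adjoint ∘L y, hter v hv x hx y hy, rfl⟩)
  intro a
  rw [star_adjoint_comp]
  exact ⟨hleft x hx y hy a, hright x hx y hy a, hleft y hy x hx a, hright y hy x hx a⟩

end Multipliers

theorem mem_of_mem_closure_of_mem_closure {X Y Z : Type*} [TopologicalSpace X]
    [TopologicalSpace Y] [TopologicalSpace Z] {f : X → Y → Z}
    (hf : Continuous fun p : X × Y => f p.1 p.2) {s : Set X} {t : Set Y} {P : Set Z}
    (hP : IsClosed P) (h : ∀ x ∈ s, ∀ y ∈ t, f x y ∈ P) {x : X} {y : Y}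
    (hx : x ∈ closure s) (hy : y ∈ closure t) : f x y ∈ P :=
  hP.closure_subset (map_mem_closure₂ hf hx hy h)

/-! ### From generators to the σ-TRO equivalence of the ranges. -/

section ClosureMembership

variable {H : Type*} [NormedAddCommGroup H] [InnerProductSpace ℂ H] [CompleteSpace H]
  {K : Type*} [NormedAddCommGroup K] [InnerProductSpace ℂ K] [CompleteSpace K]

theorem continuous_adjoint_comp_comp (T : K →L[ℂ] K) :
    Continuous fun p : (H →L[ℂ] K) × (H →L[ℂ] K) => p.1.adjoint ∘L T ∘L p.2 :=
  (ContinuousLinearMap.adjoint.continuous.comp continuous_fst).clm_comp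
    (continuous_const.clm_comp continuous_snd)

theorem continuous_comp_comp_adjoint (T : H →L[ℂ] H) :
    Continuous fun p : (H →L[ℂ] K) × (H →L[ℂ] K) => p.1 ∘L T ∘L p.2.adjoint :=
  continuous_fst.clm_comp (continuous_const.clm_comp
    (ContinuousLinearMap.adjoint.continuous.comp continuous_snd))

theorem adjoint_comp_comp_mem_of_mem_closure {T : K →L[ℂ] K} {s : Set (H →L[ℂ] K)}
    {P : Set (H →L[ℂ] H)} (hP : IsClosed P) (h : ∀ x ∈ s, ∀ y ∈ s, x.adjoint ∘L T ∘L y ∈ P)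
    {x y : H →L[ℂ] K} (hx : x ∈ closure s) (hy : y ∈ closure s) : x.adjoint ∘L T ∘L y ∈ P := by
  let f : (H →L[ℂ] K) → (H →L[ℂ] K) → (H →L[ℂ] H) := fun x y => x.adjoint ∘L T ∘L y
  have hf : Continuous fun p : (H →L[ℂ] K) × (H →L[ℂ] K) => f p.1 p.2 :=
    continuous_adjoint_comp_comp T
  have hfP : ∀ x ∈ s, ∀ y ∈ s, f x y ∈ P := h
  exact mem_of_mem_closure_of_mem_closure hf hP hfP hx hy

theorem comp_comp_adjoint_mem_of_mem_closure {T : H →L[ℂ] H} {s : Set (H →L[ℂ] K)}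
    {P : Set (K →L[ℂ] K)} (hP : IsClosed P) (h : ∀ x ∈ s, ∀ y ∈ s, x ∘L T ∘L y.adjoint ∈ P)
    {x y : H →L[ℂ] K} (hx : x ∈ closure s) (hy : y ∈ closure s) : x ∘L T ∘L y.adjoint ∈ P := by
  let f : (H →L[ℂ] K) → (H →L[ℂ] K) → (K →L[ℂ] K) := fun x y => x ∘L T ∘L y.adjoint
  have hf : Continuous fun p : (H →L[ℂ] K) × (H →L[ℂ] K) => f p.1 p.2 :=
    continuous_comp_comp_adjoint T
  have hfP : ∀ x ∈ s, ∀ y ∈ s, f x y ∈ P := h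
  exact mem_of_mem_closure_of_mem_closure hf hP hfP hx hy

end ClosureMembership

section SigmaTROEquivalence

variable {A : Type u} [NonUnitalNormedRing A] [NormedSpace ℂ A] [MatrixNormed A]
  [OperatorAlgebra A]
  {B : Type v} [NonUnitalNormedRing B] [NormedSpace ℂ B] [MatrixNormed B] [OperatorAlgebra B]
  {H₀ : Type w₁} [NormedAddCommGroup H₀] [InnerProductSpace ℂ H₀] [CompleteSpace H₀]
  {K₀ : Type w₂} [NormedAddCommGroup K₀] [InnerProductSpace ℂ K₀] [CompleteSpace K₀]
  {H : Type*} [NormedAddCommGroup H] [InnerProductSpace ℂ H] [CompleteSpace H]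
  {K : Type*} [NormedAddCommGroup K] [InnerProductSpace ℂ K] [CompleteSpace K]
  {M : Submodule ℂ (H₀ →L[ℂ] K₀)} {α₀ : A →ₙₐ[ℂ] (H₀ →L[ℂ] H₀)} {α : A →ₙₐ[ℂ] (H →L[ℂ] H)}
  {β₀ : B →ₙₐ[ℂ] (K₀ →L[ℂ] K₀)} {β : B →ₙₐ[ℂ] (K →L[ℂ] K)} {μ : M →ₗ[ℂ] (H →L[ℂ] K)}

theorem sigmaTROEquiv_of_isSigmaTRO_closure_range (hα : IsCompletelyIsometric α)
    (hβ : IsCompletelyIsometric β)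
    (hA_mem : ∀ x ∈ M, ∀ b, ∀ y ∈ M, ∃ a, α₀ a = x.adjoint ∘L β₀ b ∘L y)
    (hB_mem : ∀ x ∈ M, ∀ a, ∀ y ∈ M, ∃ b, β₀ b = x ∘L α₀ a ∘L y.adjoint)
    (hA_dense : ∀ a, a ∈ closure (Submodule.span ℂ
      {a : A | ∃ x y : M, ∃ b, α₀ a = (x : H₀ →L[ℂ] K₀).adjoint ∘L β₀ b ∘L y} : Set A))
    (hB_dense : ∀ b, b ∈ closure (Submodule.span ℂ
      {b : B | ∃ x y : M, ∃ a, β₀ b = x ∘L α₀ a ∘L (y : H₀ →L[ℂ] K₀).adjoint} : Set B))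
    (hβα : ∀ (x y : M) (a : A) (b : B),
      β₀ b = x ∘L α₀ a ∘L (y : H₀ →L[ℂ] K₀).adjoint → β b = μ x ∘L α a ∘L (μ y).adjoint)
    (hαβ : ∀ (x y : M) (a : A) (b : B),
      α₀ a = (x : H₀ →L[ℂ] K₀).adjoint ∘L β₀ b ∘L y → α a = (μ x).adjoint ∘L β b ∘L μ y)
    (hN : IsSigmaTRO (LinearMap.range μ).topologicalClosure) :
    SigmaTROEquiv (NonUnitalAlgHom.range α) (NonUnitalAlgHom.range β) := by
  have := OperatorAlgebra.complete (A := A)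
  have := OperatorAlgebra.complete (A := B)
  refine ⟨(LinearMap.range μ).topologicalClosure, hN, ?_, ?_⟩
  · refine range_eq_closure_span α hα.norm_eq hA_dense ?_ ?_
    · rintro a ⟨x, y, b, hab⟩
      exact ⟨μ x, Submodule.le_topologicalClosure _ ⟨x, rfl⟩, β b, ⟨b, rfl⟩, μ y,
        Submodule.le_topologicalClosure _ ⟨y, rfl⟩, hαβ x y a b hab⟩
    · rintro _ ⟨x, hx, _, ⟨b, rfl⟩, y, hy, rfl⟩
      refine adjoint_comp_comp_mem_of_mem_closure (s := (LinearMap.range μ : Set (H →L[ℂ] K)))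
        (isClosed_range_of_norm_eq α hα.norm_eq) ?_ hx hy
      rintro _ ⟨x, rfl⟩ _ ⟨y, rfl⟩
      obtain ⟨a, ha⟩ := hA_mem x x.2 b y y.2
      exact ⟨a, hαβ x y a b ha⟩
  · refine range_eq_closure_span β hβ.norm_eq hB_dense ?_ ?_
    · rintro b ⟨x, y, a, hab⟩
      exact ⟨μ x, Submodule.le_topologicalClosure _ ⟨x, rfl⟩, α a, ⟨a, rfl⟩, μ y,
        Submodule.le_topologicalClosure _ ⟨y, rfl⟩, hβα x y a b hab⟩
    · rintro _ ⟨x, hx, _, ⟨a, rfl⟩, y, hy, rfl⟩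
      refine comp_comp_adjoint_mem_of_mem_closure (s := (LinearMap.range μ : Set (H →L[ℂ] K)))
        (isClosed_range_of_norm_eq β hβ.norm_eq) ?_ hx hy
      rintro _ ⟨x, rfl⟩ _ ⟨y, rfl⟩
      obtain ⟨b, hb⟩ := hB_mem x x.2 a y y.2
      exact ⟨b, hβα x y a b hb⟩

end SigmaTROEquivalence

end StableMaps

end

/-! ### The theorem, with `K = ℓ²(ℕ, H)`. -/

theorem theorem3p3
    (A : Type u) [NonUnitalNormedRing A] [NormedSpace ℂ A] [StableMaps.MatrixNormed A]
    [StableMaps.OperatorAlgebra A]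
    (B : Type v) [NonUnitalNormedRing B] [NormedSpace ℂ B] [StableMaps.MatrixNormed B]
    [StableMaps.OperatorAlgebra B]
    (hAB : StableMaps.SigmaDeltaEquiv.{u, v, w₁, w₂} A B)
    (H : Type w) [NormedAddCommGroup H] [InnerProductSpace ℂ H] [CompleteSpace H]
    (α : A →ₙₐ[ℂ] (H →L[ℂ] H)) (hα : StableMaps.IsCompletelyIsometric α) :
    ∃ (K : Type w) (_ : NormedAddCommGroup K) (_ : InnerProductSpace ℂ K) (_ : CompleteSpace K)
      (β : B →ₙₐ[ℂ] (K →L[ℂ] K)), StableMaps.IsCompletelyIsometric β ∧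
        StableMaps.SigmaTROEquiv (NonUnitalAlgHom.range α) (NonUnitalAlgHom.range β) := by
  obtain ⟨H₀, _, _, _, K₀, _, _, _, α₀, β₀, hα₀, hβ₀, M, hM, hA, hB⟩ := hAB
  have hmult : ∀ x ∈ M, ∀ y ∈ M, x.adjoint ∘L y ∈ StableMaps.multiplierAlgebra α₀ :=
    fun x hx y hy => StableMaps.adjoint_comp_mem_multiplierAlgebra hM.ternary hA hx hy
  have hA_mem : ∀ x ∈ M, ∀ b, ∀ y ∈ M, ∃ a, α₀ a = x.adjoint ∘L β₀ b ∘L y := by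
    intro x hx b y hy
    have h1 : x.adjoint ∘L β₀ b ∘L y ∈ (NonUnitalAlgHom.range α₀ : Set (H₀ →L[ℂ] H₀)) := by
      rw [hA]
      exact subset_closure (Submodule.subset_span ⟨x, hx, _, ⟨b, rfl⟩, y, hy, rfl⟩)
    exact h1
  have hB_mem : ∀ x ∈ M, ∀ a, ∀ y ∈ M, ∃ b, β₀ b = x ∘L α₀ a ∘L y.adjoint := by
    intro x hx a y hy
    have h1 : x ∘L α₀ a ∘L y.adjoint ∈ (NonUnitalAlgHom.range β₀ : Set (K₀ →L[ℂ] K₀)) := by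
      rw [hB]
      exact subset_closure (Submodule.subset_span ⟨x, hx, _, ⟨a, rfl⟩, y, hy, rfl⟩)
    exact h1
  have hA_dense : ∀ a, a ∈ closure (Submodule.span ℂ
      {a : A | ∃ x y : M, ∃ b, α₀ a = (x : H₀ →L[ℂ] K₀).adjoint ∘L β₀ b ∘L y} : Set A) := by
    intro a
    refine StableMaps.mem_closure_span_of_map_mem (α₀ : A →ₗ[ℂ] (H₀ →L[ℂ] H₀)) hα₀.norm_eq ?_
      (hA.subset ⟨a, rfl⟩)
    rintro _ ⟨x, hx, _, ⟨b, rfl⟩, y, hy, rfl⟩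
    obtain ⟨a, ha⟩ := hA_mem x hx b y hy
    exact ⟨a, ⟨⟨x, hx⟩, ⟨y, hy⟩, b, ha⟩, ha⟩
  have hB_dense : ∀ b, b ∈ closure (Submodule.span ℂ
      {b : B | ∃ x y : M, ∃ a, β₀ b = x ∘L α₀ a ∘L (y : H₀ →L[ℂ] K₀).adjoint} : Set B) := by
    intro b
    refine StableMaps.mem_closure_span_of_map_mem (β₀ : B →ₗ[ℂ] (K₀ →L[ℂ] K₀)) hβ₀.norm_eq ?_
      (hB.subset ⟨b, rfl⟩)
    rintro _ ⟨x, hx, _, ⟨a, rfl⟩, y, hy, rfl⟩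
    obtain ⟨b, hb⟩ := hB_mem x hx a y hy
    exact ⟨b, ⟨⟨x, hx⟩, ⟨y, hy⟩, a, hb⟩, hb⟩
  obtain ⟨m, hm, hmlim, hmnorm⟩ := hM.left_unit
  obtain ⟨μ, hμ, hright⟩ := StableMaps.exists_ternary_representation hα₀.norm_eq
    (fun a => (hα.norm_eq a).le) StableMaps.OperatorAlgebra.approximate_identity hmult hm hmlim
    hmnorm
  obtain ⟨β, hβ, hβα, hαβ⟩ := StableMaps.exists_transferred_representation hα₀ hβ₀ hα hμ
    hM.ternary hmult hA_mem hB_dense (m := fun i => ⟨m i, hm i⟩) (fun x => hmlim x x.2) hmnorm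
  refine ⟨lp (fun _ : ℕ => H) 2, inferInstance, inferInstance, inferInstance, β, hβ,
    StableMaps.sigmaTROEquiv_of_isSigmaTRO_closure_range hα hβ hA_mem hB_mem hA_dense hB_dense
      hβα hαβ (hμ.isSigmaTRO_closure_range hM hright)⟩
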